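/- All graphs are finite, simple and undirected. Definitions. For a graph $G=(V,E)$ and $X\subseteq V$, the cut-rank $\rho_G(X)$ is the rank, over the binary field, of the submatrix of the adjacency matrix of $G$ with rows indexed by $X$ and columns indexed by $V\setminus X$. A tree is subcubic if it has at least two vertices and every vertex that is not a leaf (a vertex of degree $1$) has degree $3$; it is a caterpillar if it contains a path $P$ such that every vertex of the tree is at distance at most $1$ from some vertex of $P$. A linear rank-decomposition of $G$ is a pair $(T,L)$ where $T$ is a subcubic caterpillar and $L$ is a bijection from $V$ to the set of leaves of $T$. Its width is the maximum, over the edges $e$ of $T$, of $\rho_G(L^{-1}(X_e))$, where $(X_e,Y_e)$ is the partition of the leaves of $T$ induced by $T\setminus e$. The linear rank-width of $G$ is the minimum width of a linear rank-decomposition of $G$ (and $0$ if $|V|\le 1$). Local complementation at a vertex $v$ replaces $G$ by the graph $G*v$ obtained by complementing the adjacency between every two distinct neighbours of $v$; pivoting an edge $uv$ of $G$ replaces $G$ by $G*u*v*u$. A graph is a pivot-minor of a graph $H$ if it can be obtained from $H$ by a sequence of vertex deletions and pivotings of edges. A path-decomposition of $G$ is a pair $(T,(B_t)_{t\in V(T)})$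 of a path $T$ and sets $B_t\subseteq V$ such that $V=\bigcup_t B_t$; for every edge $uv$ of $G$ some $B_t$ contains both $u$ and $v$; and $B_{t_1}\cap B_{t_3}\subseteq B_{t_2}$ whenever $t_2$ lies on the path in $T$ from $t_1$ to $t_3$. Its width is $\max_t (|B_t|-1)$, and the path-width of $G$ is the minimum width of a path-decomposition of $G$. Theorem. Let $k$ be a non-negative integer and let $G$ be a graph of linear rank-width at most $k$ with $|V(G)|\ge 3$. Then there exists a graph $H$ such that $H$ has a pivot-minor isomorphic to $G$, the path-width of $H$ is at most $k+1$, and $|V(H)|\le (2k+1)|V(G)|-6k$. -/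

import Mathlib

namespace GraphWidth

universe u

noncomputable section

/-! ### Local complementation, pivoting, pivot-minors -/

/-- Local complementation `G * v`: the adjacency of every pair of distinct neighbours of `v`
is complemented, and all other adjacencies are kept. -/
def localComplement {V : Type u} (G : SimpleGraph V) (v : V) : SimpleGraph V where
  Adj x y := Xor (G.Adj x y) (x ≠ y ∧ G.Adj x v ∧ G.Adj y v)
  symm := by
    constructor
    intro x y h
    rcases h with ⟨h1, h2⟩ | ⟨⟨h1, h2, h3⟩, h4⟩
    · exact Or.inl ⟨h1.symm, fun ⟨a, b, c⟩ => h2 ⟨a.symm, c, b⟩⟩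
    · exact Or.inr ⟨⟨h1.symm, h3, h2⟩, fun a => h4 a.symm⟩
  loopless := by
    constructor
    intro x h
    rcases h with ⟨h1, _⟩ | ⟨⟨h1, _⟩, _⟩
    · exact G.loopless.irrefl x h1
    · exact h1 rfl

/-- `G ∧ uv = G * u * v * u`; it is only used when `uv` is an edge of `G`. -/
def pivot {V : Type u} (G : SimpleGraph V) (u v : V) : SimpleGraph V :=
  localComplement (localComplement (localComplement G u) v) u

/-- `HasPivotMinor H K`: the graph `K` is a pivot-minor of `H`, that is, `K` is obtained from `H`
by a finite sequence of vertex deletions and pivotings of edges. -/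
inductive HasPivotMinor {W : Type u} (H : SimpleGraph W) :
    ∀ {U : Type u}, SimpleGraph U → Prop
  | refl : HasPivotMinor H H
  | pivotEdge {U : Type u} {K : SimpleGraph U} {u v : U} (huv : K.Adj u v)
      (hK : HasPivotMinor H K) : HasPivotMinor H (pivot K u v)
  | deleteVertex {U : Type u} {K : SimpleGraph U} (v : U)
      (hK : HasPivotMinor H K) : HasPivotMinor H (K.induce {w : U | w ≠ v})

/-! ### Linear rank-width -/

open Classical in
/-- The cut-rank of `X`: the rank over the binary field of the submatrix of the adjacency matrix
with rows `X` and columns the complement of `X`. -/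
def cutRank {V : Type u} [Fintype V] (G : SimpleGraph V) (X : Set V) : ℕ :=
  ((G.adjMatrix (ZMod 2)).submatrix
    (Subtype.val : {v : V // v ∈ X} → V) (Subtype.val : {v : V // v ∉ X} → V)).rank

/-- A leaf is a vertex of degree `1`. -/
def IsLeaf {N : Type u} (T : SimpleGraph N) (t : N) : Prop :=
  (T.neighborSet t).ncard = 1

/-- A tree is subcubic if it has at least two vertices and every vertex that is not a leaf has
degree `3`. -/
structure IsSubcubicTree {N : Type u} (T : SimpleGraph N) : Prop where
  isTree : T.IsTree
  nontrivial : Nontrivial N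
  degree_inner : ∀ t : N, ¬ IsLeaf T t → (T.neighborSet t).ncard = 3

/-- The graph contains a path such that each vertex is at distance at most `1` from some vertex
of the path. (Used for trees, where all distances are finite.) -/
def IsCaterpillar {N : Type u} (T : SimpleGraph N) : Prop :=
  ∃ (a b : N) (p : T.Walk a b), p.IsPath ∧ ∀ t : N, ∃ s ∈ p.support, T.dist t s ≤ 1

/-- A rank-decomposition of `G`: a finite subcubic tree together with a bijection from the
vertices of `G` to the leaves of the tree. -/
structure RankDecomposition {V : Type u} (G : SimpleGraph V) where
  Node : Type
  [fintypeNode : Fintype Node]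
  tree : SimpleGraph Node
  isSubcubicTree : IsSubcubicTree tree
  leafEquiv : V ≃ {t : Node // IsLeaf tree t}

/-- For an edge `st` of the tree, the vertices of `G` whose leaf lies in the component of
`T \ st` that contains `s`. -/
def RankDecomposition.side {V : Type u} {G : SimpleGraph V} (D : RankDecomposition G)
    (s t : D.Node) : Set V :=
  {v : V | (D.tree.deleteEdges {s(s, t)}).Reachable s (D.leafEquiv v)}

/-- The width of a rank-decomposition: the maximum, over the edges `st` of the tree, of the
cut-rank of the partition of the vertices given by `T \ st`. (Each edge is counted in both
directions; the two sides are complementary and have the same cut-rank.) -/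
def RankDecomposition.width {V : Type u} [Fintype V] {G : SimpleGraph V}
    (D : RankDecomposition G) : ℕ∞ :=
  ⨆ (s : D.Node) (t : D.Node) (_ : D.tree.Adj s t), (cutRank G (D.side s t) : ℕ∞)

/-- A linear rank-decomposition is a rank-decomposition whose tree is a caterpillar. -/
structure LinearRankDecomposition {V : Type u} (G : SimpleGraph V)
    extends RankDecomposition G where
  isCaterpillar : IsCaterpillar tree

/-- The linear rank-width of a finite graph: the minimum width of its linear
rank-decompositions, and `0` if the graph has at most one vertex. -/
def linearRankWidth {V : Type u} [Fintype V] (G : SimpleGraph V) : ℕ∞ :=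
  if Fintype.card V ≤ 1 then 0
  else ⨅ D : LinearRankDecomposition G, D.toRankDecomposition.width

/-! ### Path-width -/

/-- A tree-decomposition of `G`. -/
structure TreeDecomposition {V : Type u} (G : SimpleGraph V) where
  Node : Type
  [fintypeNode : Fintype Node]
  tree : SimpleGraph Node
  isTree : tree.IsTree
  bag : Node → Set V
  exists_mem_bag : ∀ v : V, ∃ t : Node, v ∈ bag t
  exists_edge_bag : ∀ u v : V, G.Adj u v → ∃ t : Node, u ∈ bag t ∧ v ∈ bag t
  bag_inter_subset : ∀ (t₁ t₂ t₃ : Node) (p : tree.Walk t₁ t₃), p.IsPath → t₂ ∈ p.support →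
    bag t₁ ∩ bag t₃ ⊆ bag t₂

/-- The width of a tree-decomposition: the maximum of `|B_t| - 1` over all bags `B_t`. (The
subtraction only truncates for empty bags, so the value is the usual one as soon as the graph
has a vertex.) -/
def TreeDecomposition.width {V : Type u} {G : SimpleGraph V} (D : TreeDecomposition G) : ℕ∞ :=
  ⨆ t : D.Node, ((D.bag t).encard - 1)

/-- A path-decomposition is a tree-decomposition whose tree is a path. -/
structure PathDecomposition {V : Type u} (G : SimpleGraph V) extends TreeDecomposition G where
  isPath : ∃ n : ℕ, Nonempty (tree ≃g SimpleGraph.pathGraph n)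

/-- The path-width of a graph: the minimum width of its path-decompositions. -/
def pathWidth {V : Type u} (G : SimpleGraph V) : ℕ∞ :=
  ⨅ D : PathDecomposition G, D.toTreeDecomposition.width

end

end GraphWidth

/-!
Linear rank-width and pivot-minors of graphs of small path-width.

A linear rank-decomposition of width `k` gives an ordering `v₀, …, vₙ₋₁` of the vertices of `G` in
which the `n - 3` initial cuts with at least two vertices on either side have cut-rank at most `k`
(`LinearRankDecomposition.exists_order`). For each such cut `i`, choose a basis `U i` of the row
space of the cut among its initial vertices, greedily, so that `U (i + 1)` is contained in
`U i ∪ {i + 1}` and lacks at most one element of `U i`; this is possible since only one column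
is lost from one cut to the next (`exists_isTailBasisChain`).

The graph `H` is the rank-expansion of `G` (`expansion`). It has two copies `b i x` and `a i x`
of each basis element `x` of each inner cut `i`, joined by an edge, so it has at most
`n + 2k(n - 3) = (2k + 1)n - 6k` vertices. The vertex `v_j`, and the vertex `a (j - 1) x` for each
`x`, is joined to the vertices `b j y` by the coefficients of its row in the basis `U j`, and
`a (j - 1) x` is joined to `v_j` as `x` is in `G`. There are no copies at the outermost cuts;
instead, the first two vertices share a stage, and so do the last two.

* `G` is a pivot-minor of `H`: pivoting an edge and deleting its two ends takes the Schur complement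
  of the adjacency matrix over the binary field, so `H` has every Schur complement of a
  nonsingular principal block as a pivot-minor (`exists_hasPivotMinor_of_schurComplement`).
  The copies of basis elements induce a perfect matching plus a nilpotent part, and the columns of
  the Schur complement of this block are those of `G`: from `v_j` onwards, the coefficients of
  the row of `v_j` are transported from cut to cut, and evaluated at the later vertices.
* `H` has path-width at most `k + 1` (`pathWidth_expansion_le`): sweep along the ordering and, at
  the stage of `v_j`, replace the copies `a (j - 1) x` by `b j x` one at a time. As `U j` contains
  all but at most one element of `U (j - 1)`, at most `k + 2` vertices are alive at any time.
  Then replace the `b j x` by the `a j x`, again one at a time.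

For `k = 0` the graph has no edges, and `H = G`.
-/

namespace GraphWidth

/-! ### Pivot-minors by elimination of a nonsingular set of vertices -/

open Classical in
/-- The entry of the adjacency matrix of `G` over the binary field. -/
noncomputable def adjEntry {V : Type*} (G : SimpleGraph V) (x y : V) : ZMod 2 :=
  if G.Adj x y then 1 else 0

section adjEntry

variable {V : Type*} (G : SimpleGraph V)

theorem adjEntry_comm (x y : V) : adjEntry G x y = adjEntry G y x := by
  classical exact if_congr (G.adj_comm x y) rfl rfl

@[simp] theorem adjEntry_self (x : V) : adjEntry G x x = 0 := by
  simp [adjEntry]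

variable {G}

theorem adjEntry_eq_one {x y : V} : adjEntry G x y = 1 ↔ G.Adj x y := by
  by_cases h : G.Adj x y <;> simp [adjEntry, h]

theorem adjEntry_eq_zero {x y : V} : adjEntry G x y = 0 ↔ ¬ G.Adj x y := by
  by_cases h : G.Adj x y <;> simp [adjEntry, h]

theorem adj_iff_of_adjEntry_eq {W : Type*} {H : SimpleGraph W} {x y : V} {x' y' : W}
    (h : adjEntry G x y = adjEntry H x' y') : G.Adj x y ↔ H.Adj x' y' := by
  rw [← adjEntry_eq_one, ← adjEntry_eq_one, h]

end adjEntry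

theorem HasPivotMinor.trans {W : Type*} {H : SimpleGraph W} {U : Type _} {K : SimpleGraph U}
    (hK : HasPivotMinor H K) {X : Type _} {F : SimpleGraph X} (hF : HasPivotMinor K F) :
    HasPivotMinor H F := by
  induction hF with
  | refl => exact hK
  | pivotEdge huv _ ih => exact ih.pivotEdge huv
  | deleteVertex v _ ih => exact ih.deleteVertex v

theorem adjEntry_localComplement {V : Type*} (G : SimpleGraph V) (v : V) {x y : V} (hxy : x ≠ y) :
    adjEntry (localComplement G v) x y =
      adjEntry G x y + adjEntry G x v * adjEntry G y v := by
  by_cases h : G.Adj x y <;> by_cases h1 : G.Adj x v <;> by_cases h2 : G.Adj y v <;>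
    simp [adjEntry, localComplement, h, h1, h2, hxy, Xor]
  decide

/-- Away from `u` and `v`, pivoting `uv` is the Schur complement of the block of the adjacency
matrix with rows and columns `u`, `v`. -/
theorem adjEntry_pivot {V : Type*} (G : SimpleGraph V) {u v : V} (huv : G.Adj u v) {x y : V}
    (hxu : x ≠ u) (hxv : x ≠ v) (hyu : y ≠ u) (hyv : y ≠ v) :
    adjEntry (pivot G u v) x y = adjEntry G x y + adjEntry G x u * adjEntry G v y +
      adjEntry G x v * adjEntry G u y := by
  have huv1 : adjEntry G u v = 1 := adjEntry_eq_one.2 huv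
  by_cases hxy : x = y
  · subst hxy
    rw [adjEntry_self, adjEntry_self, adjEntry_comm G v x, adjEntry_comm G u x]
    generalize adjEntry G x u = a
    generalize adjEntry G x v = b
    revert a b
    decide
  · unfold pivot
    rw [adjEntry_localComplement _ _ hxy, adjEntry_localComplement _ _ hxy,
      adjEntry_localComplement _ _ hxy, adjEntry_localComplement _ _ hxu,
      adjEntry_localComplement _ _ hyu, adjEntry_localComplement _ _ hxu,
      adjEntry_localComplement _ _ hyu, adjEntry_localComplement _ _ hxv,
      adjEntry_localComplement _ _ hyv, adjEntry_localComplement _ _ huv.ne,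
      adjEntry_comm G v u, huv1, adjEntry_self, adjEntry_comm G v y, adjEntry_comm G u y]
    generalize adjEntry G x u = a
    generalize adjEntry G x v = b
    generalize adjEntry G y u = c
    generalize adjEntry G y v = d
    generalize adjEntry G x y = e
    revert a b c d e
    decide

theorem sum_eq_add_add_sum_ne {W R : Type*} [Fintype W] [AddCommMonoid R] {u v : W} (huv : u ≠ v)
    [Fintype {w : {w : W | w ≠ u} | w ≠ ⟨v, huv.symm⟩}] (g : W → R) :
    ∑ w, g w = g u + (g v + ∑ w : {w : {w : W | w ≠ u} | w ≠ ⟨v, huv.symm⟩}, g w.1.1) := by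
  classical
  rw [Fintype.sum_eq_add_sum_subtype_ne g u]
  congr 1
  rw [Fintype.sum_eq_add_sum_subtype_ne (fun w : {w : W // w ≠ u} => g w) ⟨v, huv.symm⟩]
  congr 1
  convert rfl

/-- Let `f` embed the vertices of `K` into those of `H`, and let `M` be the complement of the
range of `f`. If the block `A[M]` of the adjacency matrix `A` of `H` is nonsingular and `K` is the
Schur complement of `A[M]` in `A`, then `H` has a pivot-minor isomorphic to `K`. The Schur
complement is certified columnwise, by a vector `z` that is a unit vector outside of `M`, and
that `A` maps to zero on `M` and to a column of `K` outside of `M`. The bound `m` on the number of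
vertices of `H` is there for the induction. -/
theorem exists_hasPivotMinor_of_schurComplement {X : Type*} (K : SimpleGraph X) :
    ∀ (m : ℕ) {W : Type _} [Fintype W] (H : SimpleGraph W) (f : X → W),
      Fintype.card W ≤ m → Function.Injective f →
      (∀ z : W → ZMod 2, (∀ x, z (f x) = 0) →
        (∀ w ∉ Set.range f, ∑ y, adjEntry H w y * z y = 0) → z = 0) →
      (∀ y : X, ∃ z : W → ZMod 2, z (f y) = 1 ∧ (∀ x ≠ y, z (f x) = 0) ∧
        (∀ w ∉ Set.range f, ∑ y, adjEntry H w y * z y = 0) ∧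
        ∀ x, ∑ w, adjEntry H (f x) w * z w = adjEntry K x y) →
      ∃ (U : Type _) (F : SimpleGraph U), HasPivotMinor H F ∧ Nonempty (F ≃g K) := by
  classical
  intro m
  induction m with
  | zero =>
    intro W _ H f hm hf hker hcert
    have : IsEmpty W := Fintype.card_eq_zero_iff.1 (Nat.le_zero.1 hm)
    exact ⟨W, H, .refl, ⟨⟨(Equiv.ofBijective f ⟨hf, fun w => isEmptyElim w⟩).symm,
      fun {a} => isEmptyElim a⟩⟩⟩
  | succ m ih =>
    intro W _ H f hm hf hker hcert
    by_cases hsurj : Function.Surjective f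
    · refine ⟨W, H, .refl, ⟨SimpleGraph.Iso.symm ⟨Equiv.ofBijective f ⟨hf, hsurj⟩, ?_⟩⟩⟩
      intro x y
      obtain ⟨z, hz1, hz0, -, hz⟩ := hcert y
      have hzx := hz x
      rw [Finset.sum_eq_single (f y)] at hzx
      · rw [hz1, mul_one] at hzx
        exact adj_iff_of_adjEntry_eq hzx
      · intro w _ hw
        obtain ⟨x', rfl⟩ := hsurj w
        rw [hz0 x' (fun h => hw (h ▸ rfl)), mul_zero]
      · simp
    · have hu : ∃ u, u ∉ Set.range f := by
        by_contra! h
        exact hsurj h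
      obtain ⟨u, hu⟩ := hu
      -- `A[M]` is nonsingular, so its column `u` has a nonzero entry.
      have hv : ∃ v ∉ Set.range f, H.Adj u v := by
        by_contra! h
        have := hker (Pi.single u 1)
          (fun x => Pi.single_eq_of_ne (fun hx => hu ⟨x, hx⟩) 1) (by
            intro w hw
            rw [Finset.sum_eq_single u]
            · rw [adjEntry_eq_zero.2 (fun hwu => h w hw hwu.symm), zero_mul]
            · intro y _ hy
              rw [Pi.single_eq_of_ne hy, mul_zero]
            · simp)
        have h1 := congrFun this u
        simp at h1
      obtain ⟨v, hv, huv⟩ := hv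
      have huv1 : adjEntry H u v = 1 := adjEntry_eq_one.2 huv
      have hvu1 : adjEntry H v u = 1 := adjEntry_eq_one.2 huv.symm
      let v' : {w : W | w ≠ u} := ⟨v, huv.ne.symm⟩
      let W' := {w : {w : W | w ≠ u} | w ≠ v'}
      let H' : SimpleGraph W' := ((pivot H u v).induce {w : W | w ≠ u}).induce {w | w ≠ v'}
      have hH' : HasPivotMinor H H' :=
        ((HasPivotMinor.refl.pivotEdge huv).deleteVertex u).deleteVertex v'
      have hne (w : W') : w.1.1 ≠ u ∧ w.1.1 ≠ v :=
        ⟨w.1.2, fun h => w.2 (Subtype.ext h)⟩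
      have hentry (x y : W') : adjEntry H' x y = adjEntry H x.1.1 y.1.1 +
          adjEntry H x.1.1 u * adjEntry H v y.1.1 + adjEntry H x.1.1 v * adjEntry H u y.1.1 := by
        rw [← adjEntry_pivot H huv (hne x).1 (hne x).2 (hne y).1 (hne y).2]
        rfl
      let f' : X → W' := fun x =>
        ⟨⟨f x, fun h => hu ⟨x, h⟩⟩, fun h => hv ⟨x, congrArg Subtype.val h⟩⟩
      have hf' : ∀ w : W', w ∉ Set.range f' ↔ w.1.1 ∉ Set.range f := by
        intro w
        refine not_congr ⟨?_, ?_⟩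
        · rintro ⟨x, rfl⟩
          exact ⟨x, rfl⟩
        · rintro ⟨x, hx⟩
          exact ⟨x, Subtype.ext (Subtype.ext hx)⟩
      -- If `A z` vanishes at `u` and `v`, then eliminating `u` and `v` does not change `A z`.
      have hsum (z : W → ZMod 2) (hzu : ∑ y, adjEntry H u y * z y = 0)
          (hzv : ∑ y, adjEntry H v y * z y = 0) (w : W') :
          ∑ y, adjEntry H' w y * z y.1.1 = ∑ y, adjEntry H w.1.1 y * z y := by
        rw [sum_eq_add_add_sum_ne huv.ne] at hzu hzv ⊢
        simp only [hentry, add_mul, Finset.sum_add_distrib, mul_assoc, ← Finset.mul_sum]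
        rw [huv1, adjEntry_self, zero_mul, one_mul, zero_add] at hzu
        rw [hvu1, adjEntry_self, zero_mul, one_mul, zero_add] at hzv
        rw [CharTwo.add_eq_zero] at hzu hzv
        rw [hzu, hzv]
        ring
      have hcard : Fintype.card W' ≤ m := by
        have : Fintype.card W' < Fintype.card W :=
          Fintype.card_lt_of_injective_of_notMem (fun w : W' => w.1.1)
            (fun a b h => Subtype.ext (Subtype.ext h)) (b := u)
            (by rintro ⟨w, hw⟩; exact (hne w).1 hw)
        omega
      obtain ⟨U, F, hF, hFK⟩ := ih H' f' hcard
        (fun x y h => hf (congrArg (fun w : W' => w.1.1) h))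
        (by
          intro z hz hzM
          -- Extend `z` to `u` and `v` so that `A z` vanishes there.
          let zu := ∑ y : W', adjEntry H v y.1.1 * z y
          let zv := ∑ y : W', adjEntry H u y.1.1 * z y
          let Z : W → ZMod 2 := fun w =>
            if h : w = u then zu else if h' : w = v then zv else
              z ⟨⟨w, h⟩, fun e => h' (congrArg Subtype.val e)⟩
          have hZu : Z u = zu := by simp [Z]
          have hZv : Z v = zv := by simp [Z, huv.ne.symm]
          have hZ (w : W') : Z w.1.1 = z w := by
            simp [Z, hne w]
          have hZ1 : ∑ y, adjEntry H u y * Z y = 0 := by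
            rw [sum_eq_add_add_sum_ne huv.ne]
            simp only [hZ, hZu, hZv, adjEntry_self, huv1, one_mul, zero_mul, zero_add]
            exact CharTwo.add_self_eq_zero zv
          have hZ2 : ∑ y, adjEntry H v y * Z y = 0 := by
            rw [sum_eq_add_add_sum_ne huv.ne]
            simp only [hZ, hZu, hZv, adjEntry_self, hvu1, one_mul, zero_mul, zero_add]
            exact CharTwo.add_self_eq_zero zu
          have hZ0 : Z = 0 := by
            apply hker Z
            · intro x
              exact (hZ (f' x)).trans (hz x)
            · intro w hw
              by_cases hwu : w = u
              · rw [hwu, hZ1]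
              by_cases hwv : w = v
              · rw [hwv, hZ2]
              let w' : W' := ⟨⟨w, hwu⟩, fun e => hwv (congrArg Subtype.val e)⟩
              rw [← hsum Z hZ1 hZ2 w']
              simp only [hZ]
              exact hzM w' ((hf' w').2 hw)
          funext w
          rw [← hZ, hZ0]
          rfl)
        (by
          intro y
          obtain ⟨z, hz1, hz0, hzM, hz⟩ := hcert y
          refine ⟨fun w => z w.1.1, hz1, hz0, fun w hw => ?_, fun x => ?_⟩
          · rw [hsum z (hzM u hu) (hzM v hv)]
            exact hzM _ ((hf' w).1 hw)
          · rw [hsum z (hzM u hu) (hzM v hv)]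
            exact hz x)
      exact ⟨U, F, hH'.trans hF, hFK⟩

/-! ### Path-decompositions from interval representations -/

/-- A walk in a path graph that avoids `i` stays on one side of `i`. -/
theorem walk_pathGraph_lt_iff {n : ℕ} {i : Fin n} {u v : Fin n}
    (p : (SimpleGraph.pathGraph n).Walk u v) (hi : i ∉ p.support) {w : Fin n}
    (hw : w ∈ p.support) : i < w ↔ i < u := by
  induction p with
  | nil =>
    rw [SimpleGraph.Walk.support_nil, List.mem_singleton] at hw
    rw [hw]
  | @cons u u' v h p ih =>
    rw [SimpleGraph.Walk.support_cons, List.mem_cons, not_or] at hi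
    rw [SimpleGraph.Walk.support_cons, List.mem_cons] at hw
    have hu' : u' ≠ i := fun e => hi.2 (e ▸ p.start_mem_support)
    rw [SimpleGraph.pathGraph_adj] at h
    rcases hw with rfl | hw
    · rfl
    · rw [ih hi.2 hw]
      have h1 := hi.1
      rw [Fin.lt_def, Fin.lt_def]
      rw [← ne_eq, ← Fin.val_ne_iff] at h1
      rw [← Fin.val_ne_iff] at hu'
      omega

theorem isTree_pathGraph (n : ℕ) : (SimpleGraph.pathGraph (n + 1)).IsTree := by
  refine ⟨SimpleGraph.pathGraph_connected n, ?_⟩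
  rw [SimpleGraph.isAcyclic_iff_forall_adj_isBridge]
  have key : ∀ i : ℕ, ∀ {u v : Fin (n + 1)} (p : (SimpleGraph.pathGraph (n + 1)).Walk u v),
      (∀ a b : Fin (n + 1), a.val = i → b.val = i + 1 → s(a, b) ∉ p.edges) →
      u.val ≤ i → v.val ≤ i := by
    intro i u v p
    induction p with
    | nil => intro _ h; exact h
    | @cons u u' v h p ih =>
      intro hp hu
      simp only [SimpleGraph.Walk.edges_cons, List.mem_cons, not_or] at hp
      apply ih (fun a b ha hb => (hp a b ha hb).2)
      rw [SimpleGraph.pathGraph_adj] at h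
      by_contra hu'
      exact (hp u u' (by omega) (by omega)).1 rfl
  intro u v huv
  wlog hlt : u.val + 1 = v.val generalizing u v
  · rw [Sym2.eq_swap]
    rw [SimpleGraph.pathGraph_adj] at huv
    exact this (SimpleGraph.pathGraph_adj.2 huv.symm) (by omega)
  rw [SimpleGraph.isBridge_iff_forall_walk_mem_edges]
  refine fun p => ?_
  by_contra hp
  have := key u.val p (by
    intro a b ha hb
    rwa [Fin.ext ha, Fin.ext (hb.trans hlt)]) le_rfl
  omega

theorem isPath_pathGraph_between {n : ℕ} {u v : Fin n}
    (p : (SimpleGraph.pathGraph n).Walk u v) (hp : p.IsPath) {w : Fin n} (hw : w ∈ p.support) :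
    min u v ≤ w ∧ w ≤ max u v := by
  induction p with
  | nil =>
    rw [SimpleGraph.Walk.support_nil, List.mem_singleton] at hw
    simp [hw]
  | @cons u u' v h p ih =>
    rw [SimpleGraph.Walk.cons_isPath_iff] at hp
    rw [SimpleGraph.Walk.support_cons, List.mem_cons] at hw
    rcases hw with rfl | hw
    · simp
    · have h1 := ih hp.1 hw
      have h2 := walk_pathGraph_lt_iff p hp.2 p.end_mem_support
      have h3 : v ≠ u := fun e => hp.2 (e ▸ p.end_mem_support)
      rw [SimpleGraph.pathGraph_adj] at h
      rw [← Fin.val_ne_iff] at h3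
      simp only [Fin.lt_def, min_le_iff, le_max_iff, Fin.le_def] at *
      omega

/-- If each vertex `w` of `H` is given the interval `[lo w, hi w]` in such a way that the intervals
of adjacent vertices meet, and if no point lies in more than `c + 1` of the intervals, then the
path-width of `H` is at most `c`. -/
theorem pathWidth_le_of_intervals {W : Type*} [Fintype W] (H : SimpleGraph W) (lo hi : W → ℕ)
    (c : ℕ) (hlohi : ∀ w, lo w ≤ hi w) (hadj : ∀ u v, H.Adj u v → lo u ≤ hi v)
    (hcard : ∀ t, {w | lo w ≤ t ∧ t ≤ hi w}.encard ≤ c + 1) :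
    pathWidth H ≤ c := by
  obtain ⟨N, hN⟩ : ∃ N, ∀ w, hi w ≤ N :=
    ⟨Finset.univ.sup hi, fun w => Finset.le_sup (Finset.mem_univ w)⟩
  let D : PathDecomposition H :=
    { Node := Fin (N + 1)
      tree := SimpleGraph.pathGraph (N + 1)
      isTree := isTree_pathGraph N
      bag := fun t => {w | lo w ≤ t.val ∧ t.val ≤ hi w}
      exists_mem_bag := fun w =>
        ⟨⟨hi w, Nat.lt_succ_of_le (hN w)⟩, hlohi w, le_rfl⟩
      exists_edge_bag := fun u v huv => by
        refine ⟨⟨min (hi u) (hi v), ?_⟩, ?_, ?_⟩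
        · have := hN u
          omega
        · exact ⟨le_min (hlohi u) (hadj u v huv), min_le_left _ _⟩
        · exact ⟨le_min (hadj v u huv.symm) (hlohi v), min_le_right _ _⟩
      bag_inter_subset := by
        rintro t₁ t₂ t₃ p hp h2 w ⟨⟨h1, h1'⟩, h3, h3'⟩
        have h := isPath_pathGraph_between p hp h2
        simp only [min_le_iff, le_max_iff, Fin.le_def] at h
        exact ⟨by omega, by omega⟩
      isPath := ⟨N + 1, ⟨SimpleGraph.Iso.refl⟩⟩ }
  refine (iInf_le _ D).trans (iSup_le fun t => ?_)
  exact tsub_le_iff_right.2 (hcard t.val)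

/-! ### The vertex ordering given by a caterpillar -/

section Caterpillar

variable {N : Type*} {T : SimpleGraph N} {m : ℕ} {q : ℕ → N} {pos : N → ℕ}

/-- Let `q 0, …, q m` be a path in a tree, let every vertex `t` be equal or adjacent to
`q (pos t)`, and let the former hold for the vertices of the path. Then deleting the edge from
`q j` to `q (j + 1)` separates the vertices of position at most `j` from the others. -/
theorem reachable_deleteEdges_iff_pos_le (hT : T.IsTree)
    (hadj : ∀ j < m, T.Adj (q j) (q (j + 1)))
    (hinj : ∀ i ≤ m, ∀ j ≤ m, q i = q j → i = j)
    (hpm : ∀ t, pos t ≤ m)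
    (hpos : ∀ t, t = q (pos t) ∨ (∀ j ≤ m, t ≠ q j) ∧ T.Adj t (q (pos t)))
    {j : ℕ} (hj : j < m) (t : N) :
    (T.deleteEdges {s(q j, q (j + 1))}).Reachable (q j) t ↔ pos t ≤ j := by
  set T' := T.deleteEdges {s(q j, q (j + 1))} with hT'
  have hadj' : ∀ i < m, i ≠ j → T'.Adj (q i) (q (i + 1)) := by
    intro i hi hij
    rw [hT', SimpleGraph.deleteEdges_adj]
    refine ⟨hadj i hi, fun h => ?_⟩
    rw [Set.mem_singleton_iff, Sym2.eq_iff] at h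
    rcases h with ⟨h, -⟩ | ⟨h, h'⟩
    · exact hij (hinj i hi.le j hj.le h)
    · have h1 := hinj i hi.le (j + 1) hj h
      have h2 := hinj (i + 1) hi j hj.le h'
      omega
  have hbelow : ∀ d ≤ j, T'.Reachable (q (j - d)) (q j) := by
    intro d
    induction d with
    | zero => intro _; exact SimpleGraph.Reachable.refl _
    | succ d ih =>
      intro hd
      have h1 := hadj' (j - (d + 1)) (by omega) (by omega)
      rw [show j - (d + 1) + 1 = j - d by omega] at h1
      exact h1.reachable.trans (ih (by omega))
  have habove : ∀ d, j + 1 + d ≤ m → T'.Reachable (q (j + 1)) (q (j + 1 + d)) := by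
    intro d
    induction d with
    | zero => intro _; exact SimpleGraph.Reachable.refl _
    | succ d ih =>
      intro hd
      exact (ih (by omega)).trans (hadj' (j + 1 + d) (by omega) (by omega)).reachable
  have hspoke : T'.Reachable (q (pos t)) t := by
    rcases hpos t with h | ⟨h, ht⟩
    · rw [← h]
    · refine SimpleGraph.Adj.reachable (SimpleGraph.Adj.symm ?_)
      rw [hT', SimpleGraph.deleteEdges_adj]
      refine ⟨ht, fun h' => ?_⟩
      rw [Set.mem_singleton_iff, Sym2.eq_iff] at h'
      rcases h' with ⟨h', -⟩ | ⟨h', -⟩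
      · exact h j hj.le h'
      · exact h (j + 1) hj h'
  have hbridge : ¬ T'.Reachable (q j) (q (j + 1)) :=
    SimpleGraph.isBridge_iff.1 (SimpleGraph.isAcyclic_iff_forall_adj_isBridge.1 hT.2 (hadj j hj))
  constructor
  · intro h
    by_contra hlt
    have h1 := habove (pos t - (j + 1)) (by have := hpm t; omega)
    rw [show j + 1 + (pos t - (j + 1)) = pos t by omega] at h1
    exact hbridge (h.trans (h1.trans hspoke).symm)
  · intro h
    have h1 := hbelow (j - pos t) (by omega)
    rw [show j - (j - pos t) = pos t by omega] at h1
    exact h1.symm.trans hspoke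

/-- In a subcubic caterpillar, two leaves at the same position are the first two or the last two
leaves: otherwise the vertex of the path at this position would have degree at least four. -/
theorem not_four_leaves_of_pos_eq [Finite N] (hT : IsSubcubicTree T)
    (hadj : ∀ j < m, T.Adj (q j) (q (j + 1)))
    (hinj : ∀ i ≤ m, ∀ j ≤ m, q i = q j → i = j)
    (hpm : ∀ t, pos t ≤ m)
    (hpos : ∀ t, t = q (pos t) ∨ (∀ j ≤ m, t ≠ q j) ∧ T.Adj t (q (pos t)))
    {l x y r : N} (hl : IsLeaf T l) (hx : IsLeaf T x) (hy : IsLeaf T y) (hr : IsLeaf T r)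
    (hlx : l ≠ x) (hly : l ≠ y) (hlr : l ≠ r) (hxy : x ≠ y) (hxr : x ≠ r) (hyr : y ≠ r)
    (hpl : pos l ≤ pos x) (hpxy : pos x = pos y) (hpr : pos y ≤ pos r) : False := by
  obtain ⟨j, hj⟩ : ∃ j, pos x = j := ⟨_, rfl⟩
  have hjm : j ≤ m := hj ▸ hpm x
  have hposq : ∀ i ≤ m, pos (q i) = i := by
    intro i hi
    rcases hpos (q i) with h | ⟨h, -⟩
    · exact (hinj i hi _ (hpm _) h).symm
    · exact absurd rfl (h i hi)
  have hnear : ∀ t, pos t = j → t = q j ∨ T.Adj (q j) t := by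
    rintro t rfl
    exact (hpos t).imp id fun h => h.2.symm
  have hL : ∃ L, (L = q j ∨ T.Adj (q j) L) ∧ (pos L < j ∨ L = l) := by
    by_cases h : j = 0
    · exact ⟨l, hnear l (by omega), .inr rfl⟩
    · have h1 := hadj (j - 1) (by omega)
      rw [show j - 1 + 1 = j by omega] at h1
      exact ⟨q (j - 1), .inr h1.symm, .inl (by rw [hposq _ (by omega)]; omega)⟩
  have hR : ∃ R, (R = q j ∨ T.Adj (q j) R) ∧ (j < pos R ∨ R = r) := by
    by_cases h : j = m
    · exact ⟨r, hnear r (by have := hpm r; omega), .inr rfl⟩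
    · exact ⟨q (j + 1), .inr (hadj j (by omega)), .inl (by rw [hposq _ (by omega)]; omega)⟩
  obtain ⟨L, hL1, hL2⟩ := hL
  obtain ⟨R, hR1, hR2⟩ := hR
  have hLx : L ≠ x := by
    rintro rfl
    rcases hL2 with h | h
    · omega
    · exact hlx h.symm
  have hLy : L ≠ y := by
    rintro rfl
    rcases hL2 with h | h
    · omega
    · exact hly h.symm
  have hRx : R ≠ x := by
    rintro rfl
    rcases hR2 with h | h
    · omega
    · exact hxr h
  have hRy : R ≠ y := by
    rintro rfl
    rcases hR2 with h | h
    · omega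
    · exact hyr h
  have hLR : L ≠ R := by
    rintro rfl
    rcases hL2 with h | h <;> rcases hR2 with h' | h'
    · omega
    · subst h'; omega
    · subst h; omega
    · exact hlr (h.symm.trans h')
  have hcard : ({x, y, L, R} : Set N).ncard = 4 := by
    rw [Set.ncard_insert_of_notMem (by simp [hxy, hLx.symm, hRx.symm]),
      Set.ncard_insert_of_notMem (by simp [hLy.symm, hRy.symm]), Set.ncard_pair hLR]
  have hmem : ∀ t ∈ ({x, y, L, R} : Set N), t = q j ∨ T.Adj (q j) t := by
    rintro t (rfl | rfl | rfl | rfl)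
    · exact hnear _ hj
    · exact hnear _ (by omega)
    · exact hL1
    · exact hR1
  have hinner : ¬ IsLeaf T (q j) := by
    intro hleaf
    have h1 : ({x, y, L, R} : Set N) ⊆ insert (q j) (T.neighborSet (q j)) := hmem
    have h2 := Set.ncard_le_ncard h1
    have h3 := Set.ncard_insert_le (q j) (T.neighborSet (q j))
    rw [IsLeaf] at hleaf
    omega
  have hne : ∀ t ∈ ({x, y, L, R} : Set N), t ≠ q j := by
    have hq : pos (q j) = j := hposq j hjm
    rintro t (rfl | rfl | rfl | rfl) rfl
    · exact hinner hx
    · exact hinner hy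
    · rcases hL2 with h | h
      · omega
      · exact hinner (h ▸ hl)
    · rcases hR2 with h | h
      · omega
      · exact hinner (h ▸ hr)
  have h1 : ({x, y, L, R} : Set N) ⊆ T.neighborSet (q j) :=
    fun t ht => (hmem t ht).resolve_left (hne t ht)
  have h2 := Set.ncard_le_ncard h1
  rw [hT.degree_inner _ hinner] at h2
  omega

end Caterpillar

theorem RankDecomposition.cutRank_side_le_width {V : Type*} [Fintype V] {G : SimpleGraph V}
    (D : RankDecomposition G) {s t : D.Node} (hst : D.tree.Adj s t) :
    (cutRank G (D.side s t) : ℕ∞) ≤ D.width :=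
  le_iSup_of_le s (le_iSup_of_le t (le_iSup_of_le hst le_rfl))

/-- A linear rank-decomposition orders the vertices in such a way that each initial segment with
at least two vertices inside and outside is a side of the decomposition, and so has cut-rank at
most `k`: sort the vertices by the position of their leaves along the path. -/
theorem LinearRankDecomposition.exists_order {V : Type*} [Fintype V] {G : SimpleGraph V}
    (D : LinearRankDecomposition G) {k : ℕ} (hD : D.width ≤ k) :
    ∃ e : V ≃ Fin (Fintype.card V), ∀ i, 2 ≤ i → i + 2 ≤ Fintype.card V →
      cutRank G {v | (e v).val < i} ≤ k := by
  have := D.fintypeNode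
  obtain ⟨a, b, p, hp, hcat⟩ := D.isCaterpillar
  have htree : D.tree.IsTree := D.isSubcubicTree.isTree
  have hadj : ∀ j < p.length, D.tree.Adj (p.getVert j) (p.getVert (j + 1)) :=
    fun j hj => p.adj_getVert_succ hj
  have hinj : ∀ i ≤ p.length, ∀ j ≤ p.length, p.getVert i = p.getVert j → i = j :=
    fun i hi j hj h => hp.getVert_injOn hi hj h
  have hex : ∀ t : D.Node, ∃ i ≤ p.length, t = p.getVert i ∨
      (∀ j ≤ p.length, t ≠ p.getVert j) ∧ D.tree.Adj t (p.getVert i) := by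
    intro t
    by_cases ht : t ∈ p.support
    · obtain ⟨i, hi, hip⟩ := SimpleGraph.Walk.mem_support_iff_exists_getVert.1 ht
      exact ⟨i, hip, .inl hi.symm⟩
    · obtain ⟨s, hs, hts⟩ := hcat t
      obtain ⟨i, hi, hip⟩ := SimpleGraph.Walk.mem_support_iff_exists_getVert.1 hs
      refine ⟨i, hip, .inr ⟨fun j _ h => ht (h ▸ p.getVert_mem_support j), ?_⟩⟩
      rw [hi, ← SimpleGraph.dist_eq_one_iff_adj]
      have h0 : D.tree.dist t s ≠ 0 := by
        rw [Ne, htree.1.dist_eq_zero_iff]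
        rintro rfl
        exact ht hs
      omega
  choose pos hpm hpos using hex
  let e₀ := Fintype.equivFin V
  let f : Fin (Fintype.card V) → ℕ := fun i => pos (D.leafEquiv (e₀.symm i))
  let e := e₀.trans (Tuple.sort f).symm
  have hmono : ∀ i j, i ≤ j → pos (D.leafEquiv (e.symm i)) ≤ pos (D.leafEquiv (e.symm j)) :=
    Tuple.monotone_sort f
  refine ⟨e, fun i hi2 hin => ?_⟩
  rcases (hmono ⟨i - 1, by omega⟩ ⟨i, by omega⟩ (by simp [Fin.le_def])).lt_or_eq with hlt | heq
  · obtain ⟨j, hji⟩ : ∃ j, pos (D.leafEquiv (e.symm ⟨i - 1, by omega⟩)) = j := ⟨_, rfl⟩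
    have hj : j < p.length := hji ▸ hlt.trans_le (hpm _)
    have hside : {v | (e v).val < i} = D.side (p.getVert j) (p.getVert (j + 1)) := by
      ext v
      refine Iff.trans ?_ (reachable_deleteEdges_iff_pos_le htree hadj hinj hpm hpos hj _).symm
      rw [Set.mem_ofPred_eq]
      constructor
      · intro h
        have := hmono (e v) ⟨i - 1, by omega⟩ (by rw [Fin.le_def]; simp only; omega)
        rwa [Equiv.symm_apply_apply, hji] at this
      · intro h
        by_contra hv
        have := hmono ⟨i, by omega⟩ (e v) (by rw [Fin.le_def]; simp only; omega)
        rw [Equiv.symm_apply_apply] at this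
        omega
    rw [hside]
    exact_mod_cast (D.cutRank_side_le_width (hadj _ hj)).trans hD
  · exfalso
    have hne : ∀ i j, i ≠ j →
        (D.leafEquiv (e.symm i) : D.Node) ≠ D.leafEquiv (e.symm j) := by
      intro i j hij h
      exact hij (e.symm.injective (D.leafEquiv.injective (Subtype.ext h)))
    refine not_four_leaves_of_pos_eq D.isSubcubicTree hadj hinj hpm hpos
      (D.leafEquiv (e.symm ⟨0, by omega⟩)).2 (D.leafEquiv (e.symm ⟨i - 1, by omega⟩)).2
      (D.leafEquiv (e.symm ⟨i, by omega⟩)).2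
      (D.leafEquiv (e.symm ⟨Fintype.card V - 1, by omega⟩)).2
      (hne _ _ ?_) (hne _ _ ?_) (hne _ _ ?_) (hne _ _ ?_) (hne _ _ ?_) (hne _ _ ?_)
      (hmono _ _ ?_) heq (hmono _ _ ?_)
    all_goals simp only [ne_eq, Fin.mk.injEq, Fin.mk_le_mk]; omega

theorem not_adj_of_cutRank_eq_zero {V : Type*} [Fintype V] {G : SimpleGraph V} {X : Set V}
    (h : cutRank G X = 0) {u v : V} (hu : u ∈ X) (hv : v ∉ X) : ¬ G.Adj u v := by
  classical
  rw [cutRank, Matrix.rank, Module.finrank_eq_zero_iff_of_free, Submodule.subsingleton_iff_eq_bot,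
    LinearMap.range_eq_bot] at h
  have := congrFun (congrArg (fun f => f (Pi.single ⟨v, hv⟩ 1)) h) ⟨u, hu⟩
  simpa using this

/-- The edge of the tree at a leaf cuts off a single vertex, so a graph with a
rank-decomposition of width zero has no edges. -/
theorem RankDecomposition.not_adj_of_width_eq_zero {V : Type*} [Fintype V] {G : SimpleGraph V}
    (D : RankDecomposition G) (hD : D.width ≤ 0) (u v : V) : ¬ G.Adj u v := by
  intro huv
  have := D.isSubcubicTree.nontrivial
  obtain ⟨t, ht⟩ := D.isSubcubicTree.isTree.1.preconnected.exists_adj_of_nontrivial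
    (D.leafEquiv u : D.Node)
  have hleaf := (D.leafEquiv u).2
  rw [IsLeaf, Set.ncard_eq_one] at hleaf
  obtain ⟨t', ht'⟩ := hleaf
  have htt' : t = t' := by
    have : t ∈ D.tree.neighborSet (D.leafEquiv u) := ht
    rwa [ht'] at this
  have hrank : cutRank G (D.side (D.leafEquiv u) t) = 0 := by
    have := (D.cutRank_side_le_width ht).trans hD
    simpa using this
  refine not_adj_of_cutRank_eq_zero hrank (u := u) (v := v)
    (SimpleGraph.Reachable.refl _) ?_ huv
  rintro ⟨w⟩
  have hne : (D.leafEquiv u : D.Node) ≠ D.leafEquiv v :=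
    fun h => huv.ne (D.leafEquiv.injective (Subtype.ext h))
  have hw := w.adj_snd (w.not_nil_of_ne hne)
  rw [SimpleGraph.deleteEdges_adj] at hw
  have hs : w.snd ∈ D.tree.neighborSet (D.leafEquiv u) := hw.1
  rw [ht', Set.mem_singleton_iff] at hs
  exact hw.2 (by rw [hs, htt']; rfl)

theorem exists_linearRankDecomposition_of_linearRankWidth_le {V : Type*} [Fintype V]
    {G : SimpleGraph V} {k : ℕ} (hG : linearRankWidth G ≤ k) (hV : 2 ≤ Fintype.card V) :
    ∃ D : LinearRankDecomposition G, D.width ≤ k := by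
  rw [linearRankWidth, if_neg (by omega)] at hG
  by_contra! h
  have h1 : (k : ℕ∞) + 1 ≤ ⨅ D : LinearRankDecomposition G, D.toRankDecomposition.width :=
    le_iInf fun D => Order.add_one_le_of_lt (h D)
  have h2 := h1.trans hG
  norm_cast at h2
  omega

/-! ### Nested bases of the row spaces of the initial cuts -/

open Submodule in
/-- Let the vectors `r' x` be obtained from `r x` by a linear map that changes `r x` by a multiple
of `e` only. A basis `S` for `r` loses at most one element on passing to `r'`, even if one more
vector `r' z` is to be spanned. -/
theorem exists_linearIndepOn_subset_insert {ι 𝕜 E : Type*} [DecidableEq ι] [Field 𝕜]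
    [AddCommGroup E] [Module 𝕜 E] (r r' : ι → E) (e : E) (he : ∀ x, r x - r' x ∈ span 𝕜 {e})
    (S : Finset ι) (z : ι) (hS : LinearIndepOn 𝕜 r (S : Set ι)) :
    ∃ S' ⊆ insert z S, LinearIndepOn 𝕜 r' (S' : Set ι) ∧ (S \ S').card ≤ 1 ∧
      ∀ x ∈ insert z S, r' x ∈ span 𝕜 (r' '' (S' : Set ι)) := by
  classical
  obtain ⟨I, hIS, -, hspanI, hI⟩ := exists_linearIndepOn_extension
    (linearIndepOn_empty 𝕜 r') (Set.empty_subset (S : Set ι))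
  obtain ⟨J, hJS, hIJ, hspanJ, hJ⟩ := exists_linearIndepOn_extension hI
    (t := ((insert z S : Finset ι) : Set ι))
    (hIS.trans (by rw [Finset.coe_insert]; exact Set.subset_insert _ _))
  lift I to Finset ι using S.finite_toSet.subset hIS
  lift J to Finset ι using (insert z S).finite_toSet.subset hJS
  rw [Finset.coe_subset] at hIS hJS hIJ
  refine ⟨J, hJS, hJ, ?_, fun x hx => hspanJ ⟨x, hx, rfl⟩⟩
  have hle : span 𝕜 (r '' (S : Set ι)) ≤ span 𝕜 (((insert e (I.image r') : Finset E)) : Set E) := by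
    rw [span_le]
    rintro _ ⟨x, hx, rfl⟩
    have h1 : r' x ∈ span 𝕜 (((insert e (I.image r') : Finset E)) : Set E) := by
      refine span_mono ?_ (hspanI ⟨x, hx, rfl⟩)
      rw [Finset.coe_insert, Finset.coe_image]
      exact Set.subset_insert _ _
    have h2 : r x - r' x ∈ span 𝕜 (((insert e (I.image r') : Finset E)) : Set E) :=
      span_mono (by simp) (he x)
    simpa using add_mem h2 h1
  have h1 : S.card ≤ I.card + 1 := by
    have hr : Module.finrank 𝕜 (span 𝕜 (r '' (S : Set ι))) = S.card := by
      have := finrank_span_eq_card hS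
      rw [← Set.image_eq_range] at this
      simpa using this
    have h2 := Submodule.finrank_mono hle
    have h3 := finrank_span_finset_le_card (R := 𝕜) (insert e (I.image r'))
    have h4 := Finset.card_insert_le e (I.image r')
    have h5 : (I.image r').card ≤ I.card := Finset.card_image_le
    rw [Set.finrank] at h3
    omega
  have h2 : (S \ J).card ≤ (S \ I).card :=
    Finset.card_le_card (Finset.sdiff_subset_sdiff le_rfl hIJ)
  rw [Finset.card_sdiff_of_subset hIS] at h2
  omega

/-- The row `x` of the matrix `A`, with the entries in the columns `y ≤ i` replaced by zero. -/
def tailRow (A : ℕ → ℕ → ZMod 2) (i x : ℕ) : ℕ → ZMod 2 :=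
  fun y => if i < y then A x y else 0

/-- `IsTailBasis A i S`: the rows in `S` form a basis of the row space of the matrix with rows
`0, …, i` and columns `i + 1, i + 2, …`. -/
structure IsTailBasis (A : ℕ → ℕ → ZMod 2) (i : ℕ) (S : Finset ℕ) : Prop where
  le_of_mem : ∀ x ∈ S, x ≤ i
  linearIndepOn : LinearIndepOn (ZMod 2) (tailRow A i) (S : Set ℕ)
  mem_span : ∀ x ≤ i, tailRow A i x ∈ Submodule.span (ZMod 2) (tailRow A i '' (S : Set ℕ))

section

variable {A : ℕ → ℕ → ZMod 2} {i : ℕ} {S : Finset ℕ}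

theorem exists_isTailBasis_zero (A : ℕ → ℕ → ZMod 2) : ∃ S, IsTailBasis A 0 S := by
  obtain ⟨S, hS, h1, -, h2⟩ := exists_linearIndepOn_subset_insert (𝕜 := ZMod 2)
    (tailRow A 0) (tailRow A 0) 0 (by simp) ∅ 0 (by simp)
  refine ⟨S, fun x hx => ?_, h1, fun x hx => h2 x ?_⟩
  · simpa using hS hx
  · simpa using hx

/-- Only the column `i + 1` is lost on passing from one cut to the next, so the rank drops by at
most one. -/
theorem IsTailBasis.exists_succ (h : IsTailBasis A i S) :
    ∃ S', IsTailBasis A (i + 1) S' ∧ S' ⊆ insert (i + 1) S ∧ (S \ S').card ≤ 1 := by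
  let L : (ℕ → ZMod 2) →ₗ[ZMod 2] (ℕ → ZMod 2) :=
    LinearMap.pi fun y => if i + 1 < y then LinearMap.proj y else 0
  have hL : ∀ x, L (tailRow A i x) = tailRow A (i + 1) x := by
    intro x
    funext y
    by_cases hy : i + 1 < y
    · simp [L, tailRow, hy, show i < y by omega]
    · simp [L, tailRow, hy]
  obtain ⟨S', hS', h1, h2, h3⟩ := exists_linearIndepOn_subset_insert (𝕜 := ZMod 2)
    (tailRow A i) (tailRow A (i + 1)) (Pi.single (i + 1) 1) (by
      intro x
      rw [Submodule.mem_span_singleton]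
      refine ⟨A x (i + 1), ?_⟩
      funext y
      by_cases hy : y = i + 1
      · subst hy
        simp [tailRow]
      · by_cases hy' : i < y
        · simp [tailRow, hy, hy', show i + 1 < y by omega]
        · simp [tailRow, hy, hy', show ¬ i + 1 < y by omega]) S (i + 1) h.linearIndepOn
  refine ⟨S', ⟨fun x hx => ?_, h1, fun x hx => ?_⟩, hS', h2⟩
  · rcases Finset.mem_insert.1 (hS' hx) with rfl | hx
    · rfl
    · exact (h.le_of_mem x hx).trans (Nat.le_succ i)
  · rcases Nat.le_succ_iff.1 hx with hx | rfl
    · have h4 := Submodule.mem_map_of_mem (f := L) (h.mem_span x hx)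
      rw [hL, Submodule.map_span, Set.image_image] at h4
      refine Submodule.span_le.2 ?_ h4
      rintro _ ⟨y, hy, rfl⟩
      simp only [hL]
      exact h3 y (Finset.mem_insert_of_mem hy)
    · exact h3 _ (Finset.mem_insert_self _ _)

theorem IsTailBasis.exists_coeff (h : IsTailBasis A i S) {x : ℕ} (hx : x ≤ i) :
    ∃ c : ℕ → ZMod 2, ∀ y > i, ∑ z ∈ S, c z * A z y = A x y := by
  obtain ⟨c, hc⟩ := (Submodule.mem_span_image_finset_iff_exists_fun' (ZMod 2)).1 (h.mem_span x hx)
  refine ⟨c, fun y hy => ?_⟩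
  have := congrFun hc y
  simpa [tailRow, hy] using this

theorem IsTailBasis.eq_of_sum_eq (h : IsTailBasis A i S) {c d : ℕ → ZMod 2}
    (hcd : ∀ y > i, ∑ z ∈ S, c z * A z y = ∑ z ∈ S, d z * A z y) {z : ℕ} (hz : z ∈ S) :
    c z = d z := by
  have := linearIndepOn_finset_iff.1 h.linearIndepOn (fun z => c z - d z) (by
    funext y
    by_cases hy : i < y
    · simp [tailRow, hy, sub_mul, hcd y hy]
    · simp [tailRow, hy]) z hz
  exact sub_eq_zero.1 this

end

/-- A chain of bases `U i`, with the coefficients `c i x` of the row `x ≤ i` with respect to the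
basis `U i`. By uniqueness, the coefficients at consecutive cuts are compatible. -/
structure IsTailBasisChain (A : ℕ → ℕ → ZMod 2) (U : ℕ → Finset ℕ) (c : ℕ → ℕ → ℕ → ZMod 2) :
    Prop where
  isTailBasis : ∀ i, IsTailBasis A i (U i)
  subset_insert : ∀ i, U (i + 1) ⊆ insert (i + 1) (U i)
  card_sdiff : ∀ i, (U i \ U (i + 1)).card ≤ 1
  sum_coeff : ∀ i, ∀ x ≤ i, ∀ y > i, ∑ z ∈ U i, c i x z * A z y = A x y
  coeff_of_mem : ∀ i, ∀ x ∈ U i, ∀ y ∈ U i, c i x y = if x = y then 1 else 0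
  coeff_succ : ∀ i, ∀ j ≤ i, ∀ y ∈ U (i + 1),
    c (i + 1) j y = ∑ x ∈ U i, c i j x * c (i + 1) x y

theorem exists_isTailBasisChain (A : ℕ → ℕ → ZMod 2) : ∃ U c, IsTailBasisChain A U c := by
  obtain ⟨S₀, hS₀⟩ := exists_isTailBasis_zero A
  choose next hnext hsub hcard using
    fun i (S : {S // IsTailBasis A i S}) => S.2.exists_succ
  let U' : (i : ℕ) → {S // IsTailBasis A i S} :=
    fun i => Nat.rec ⟨S₀, hS₀⟩ (fun i S => ⟨next i S, hnext i S⟩) i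
  choose c hc using fun i (x : {x // x ≤ i}) => (U' i).2.exists_coeff x.2
  let C : ℕ → ℕ → ℕ → ZMod 2 := fun i x => if h : x ≤ i then c i ⟨x, h⟩ else 0
  have hC : ∀ i, ∀ x ≤ i, ∀ y > i, ∑ z ∈ (U' i).1, C i x z * A z y = A x y := by
    intro i x hx y hy
    simp only [C, dif_pos hx]
    exact hc i ⟨x, hx⟩ y hy
  refine ⟨fun i => (U' i).1, C, fun i => (U' i).2, fun i => hsub i (U' i),
    fun i => hcard i (U' i), hC, ?_, ?_⟩
  · intro i x hx y hy
    refine (U' i).2.eq_of_sum_eq (d := fun y => if x = y then 1 else 0) (fun w hw => ?_) hy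
    rw [hC i x ((U' i).2.le_of_mem x hx) w hw]
    simp only [ite_mul, one_mul, zero_mul]
    rw [Finset.sum_ite_eq, if_pos hx]
  · intro i j hj y hy
    refine (U' (i + 1)).2.eq_of_sum_eq
      (d := fun y => ∑ x ∈ (U' i).1, C i j x * C (i + 1) x y) (fun w hw => ?_) hy
    rw [hC (i + 1) j (by omega) w hw]
    simp only [Finset.sum_mul]
    rw [Finset.sum_comm, ← hC i j hj w (by omega)]
    refine Finset.sum_congr rfl fun x hx => ?_
    have := (U' i).2.le_of_mem x hx
    rw [← hC (i + 1) x (by omega) w hw, Finset.mul_sum]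
    simp only [mul_assoc]

/-- If the matrix `A` encodes the graph `G` along an ordering `e` of its vertices, then a basis of
the row space of an initial cut has as many elements as the cut-rank at most. -/
theorem IsTailBasis.card_le_cutRank {V : Type*} [Fintype V] {G : SimpleGraph V} {n : ℕ}
    (e : V ≃ Fin n) {A : ℕ → ℕ → ZMod 2} (hA : ∀ u v, A (e u) (e v) = adjEntry G u v)
    (hA0 : ∀ x y, n ≤ y → A x y = 0) {i : ℕ} (hi : i < n) {S : Finset ℕ}
    (h : IsTailBasis A i S) : S.card ≤ cutRank G {v | (e v).val < i + 1} := by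
  classical
  obtain ⟨X, hX⟩ : ∃ X : Set V, X = {v | (e v).val < i + 1} := ⟨_, rfl⟩
  have hmem : ∀ v, v ∈ X ↔ (e v).val < i + 1 := fun v => by rw [hX]; rfl
  rw [← hX, cutRank, Matrix.rank_eq_finrank_span_row]
  set M := (G.adjMatrix (ZMod 2)).submatrix
    (Subtype.val : {v : V // v ∈ X} → V) (Subtype.val : {v : V // v ∉ X} → V) with hM
  have hlt (x : S) : x.1 < i + 1 := Nat.lt_succ_of_le (h.le_of_mem x x.2)
  let ρ : S → {v : V // v ∈ X} := fun x =>
    ⟨e.symm ⟨x, by have := hlt x; omega⟩, by rw [hmem]; simpa using hlt x⟩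
  -- `L` extends a row of the submatrix by zeros.
  let L : ({v : V // v ∉ X} → ZMod 2) →ₗ[ZMod 2] (ℕ → ZMod 2) :=
    LinearMap.pi fun y => if hy : i < y ∧ y < n then
      LinearMap.proj ⟨e.symm ⟨y, hy.2⟩, by rw [hmem]; simpa using hy.1⟩ else 0
  have hL : ∀ x : S, L (M (ρ x)) = tailRow A i x := by
    intro x
    funext y
    by_cases hy : i < y ∧ y < n
    · have h1 := hA (e.symm ⟨x, by have := hlt x; omega⟩) (e.symm ⟨y, hy.2⟩)
      simp only [Equiv.apply_symm_apply] at h1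
      simp [L, tailRow, hy, hM, ρ, h1, adjEntry, SimpleGraph.adjMatrix_apply]
    · by_cases hy' : i < y
      · simp [L, tailRow, hy, hA0 x y (by omega)]
      · simp [L, tailRow, hy']
  have hli : LinearIndependent (ZMod 2) (fun x : S => M (ρ x)) := by
    refine LinearIndependent.of_comp L ?_
    have h1 : (L ∘ fun x : S => M (ρ x)) = fun x : S => tailRow A i x := funext hL
    rw [h1]
    exact h.linearIndepOn
  have h1 := finrank_span_eq_card hli
  rw [Fintype.card_coe] at h1
  rw [← h1]
  refine Submodule.finrank_mono (Submodule.span_mono ?_)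
  rintro _ ⟨x, rfl⟩
  exact ⟨ρ x, rfl⟩

/-! ### The rank-expansion of an ordered graph -/

/-- The bases at the cuts `{0, …, i} | {i + 1, …, n - 1}` with at least two vertices on either
side; all others are replaced by the empty set. -/
def innerBasis (n : ℕ) (U : ℕ → Finset ℕ) (i : ℕ) : Finset ℕ :=
  if 1 ≤ i ∧ i + 3 ≤ n then U i else ∅

theorem innerBasis_eq {n : ℕ} (U : ℕ → Finset ℕ) {i : ℕ} (h1 : 1 ≤ i) (h2 : i + 3 ≤ n) :
    innerBasis n U i = U i :=
  if_pos ⟨h1, h2⟩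

theorem mem_innerBasis {n : ℕ} {U : ℕ → Finset ℕ} {i x : ℕ} :
    x ∈ innerBasis n U i ↔ (1 ≤ i ∧ i + 3 ≤ n) ∧ x ∈ U i := by
  unfold innerBasis
  split_ifs with h <;> simp [h]

/-- The stage at which the vertex `j` is processed: its index, except that the first two vertices
share a stage, and so do the last two. -/
def stage (n j : ℕ) : ℕ := max 1 (min j (n - 2))

/-- A vertex of the rank-expansion is a vertex `j` of the graph, or, for some inner cut `i`
and some element `x` of the basis `U i`, the outgoing copy `a i x` or the ingoing copy `b i x`
of `x`. -/
abbrev ExpansionVertex (n : ℕ) (U : ℕ → Finset ℕ) : Type :=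
  Fin n ⊕ ((Σ i : Fin n, innerBasis n U i) ⊕ (Σ i : Fin n, innerBasis n U i))

/-- The adjacency matrix of the rank-expansion. At each stage, the outgoing vertices
of the preceding cut, the vertices of the stage, and the ingoing vertices of the following cut are
joined: the former two as in the graph, and both to the ingoing vertices by the coefficients of
their rows. The ingoing and the outgoing copy of a basis element are matched. -/
def expansionEntry (n : ℕ) (A : ℕ → ℕ → ZMod 2) (U : ℕ → Finset ℕ) (c : ℕ → ℕ → ℕ → ZMod 2) :
    ExpansionVertex n U → ExpansionVertex n U → ZMod 2
  | .inl j, .inl l => if stage n j = stage n l then A j l else 0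
  | .inl j, .inr (.inl ⟨i, x⟩) => if i.val + 1 = stage n j then A x j else 0
  | .inl j, .inr (.inr ⟨i, y⟩) => if i.val = stage n j then c i j y else 0
  | .inr (.inl ⟨i, x⟩), .inl j => if i.val + 1 = stage n j then A x j else 0
  | .inr (.inr ⟨i, y⟩), .inl j => if i.val = stage n j then c i j y else 0
  | .inr (.inl ⟨i, x⟩), .inr (.inr ⟨i', y⟩) =>
      (if i.val = i'.val ∧ x.val = y.val then 1 else 0) +
        if i.val + 1 = i'.val then c i' x y else 0
  | .inr (.inr ⟨i', y⟩), .inr (.inl ⟨i, x⟩) =>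
      (if i.val = i'.val ∧ x.val = y.val then 1 else 0) +
        if i.val + 1 = i'.val then c i' x y else 0
  | .inr (.inl _), .inr (.inl _) => 0
  | .inr (.inr _), .inr (.inr _) => 0

section Expansion

variable {n : ℕ} {A : ℕ → ℕ → ZMod 2} {U : ℕ → Finset ℕ} {c : ℕ → ℕ → ℕ → ZMod 2}

theorem expansionEntry_comm (hsymm : ∀ x y, A x y = A y x) (u v : ExpansionVertex n U) :
    expansionEntry n A U c u v = expansionEntry n A U c v u := by
  rcases u with j | ⟨i, x⟩ | ⟨i, x⟩ <;> rcases v with l | ⟨i', y⟩ | ⟨i', y⟩ <;>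
    simp only [expansionEntry]
  simp only [hsymm j l, eq_comm]

/-- The rank-expansion of the graph on `0, …, n - 1` with the adjacency matrix `A`, with respect
to the bases `U i` and the coefficients `c i`. -/
def expansion (n : ℕ) (A : ℕ → ℕ → ZMod 2) (U : ℕ → Finset ℕ) (c : ℕ → ℕ → ℕ → ZMod 2)
    (hsymm : ∀ x y, A x y = A y x) (hdiag : ∀ x, A x x = 0) :
    SimpleGraph (ExpansionVertex n U) where
  Adj u v := expansionEntry n A U c u v = 1
  symm := ⟨fun u v h => by rwa [expansionEntry_comm hsymm]⟩
  loopless := ⟨fun u h => by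
    rcases u with j | ⟨i, x⟩ | ⟨i, x⟩ <;> simp [expansionEntry, hdiag] at h⟩

theorem adjEntry_expansion (hsymm : ∀ x y, A x y = A y x) (hdiag : ∀ x, A x x = 0)
    (u v : ExpansionVertex n U) :
    adjEntry (expansion n A U c hsymm hdiag) u v = expansionEntry n A U c u v := by
  have h01 : ∀ a : ZMod 2, a ≠ 1 → 0 = a := by decide
  by_cases h : expansionEntry n A U c u v = 1
  · rw [h]
    exact adjEntry_eq_one.2 h
  · rw [← h01 _ h]
    exact adjEntry_eq_zero.2 h

theorem sum_layer_eq (F : ℕ → ℕ → ZMod 2) (i₀ : ℕ)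
    (hF : ∀ i, i ≠ i₀ → ∀ x ∈ innerBasis n U i, F i x = 0) :
    ∑ p : (Σ i : Fin n, innerBasis n U i), F p.1 p.2 = ∑ x ∈ innerBasis n U i₀, F i₀ x := by
  rw [Fintype.sum_sigma]
  simp only
  rw [← Finset.sum_range fun i => ∑ x : innerBasis n U i, F i x]
  rw [Finset.sum_eq_single i₀]
  · exact Finset.sum_coe_sort (innerBasis n U i₀) (F i₀)
  · intro i _ hi
    exact Finset.sum_eq_zero fun x _ => hF i hi x x.2
  · intro hi
    refine Finset.sum_eq_zero fun x _ => ?_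
    have := (mem_innerBasis.1 x.2).1
    rw [Finset.mem_range] at hi
    omega

theorem one_le_stage (n j : ℕ) : 1 ≤ stage n j := le_max_left _ _

theorem stage_le (hn : 3 ≤ n) (j : ℕ) : stage n j + 2 ≤ n := by
  unfold stage; omega

theorem le_of_stage_le {i j : ℕ} (hi : i + 3 ≤ n) (h : stage n j ≤ i) : j ≤ i := by
  unfold stage at h; omega

theorem lt_of_lt_stage {i j : ℕ} (hi : 1 ≤ i) (h : i < stage n j) : i < j := by
  unfold stage at h; omega

/-- The block of the rank-expansion that belongs to the copies of basis elements is a perfect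
matching plus a nilpotent part, hence nonsingular. -/
theorem eq_zero_of_expansion_mulVec_eq_zero (hsymm : ∀ x y, A x y = A y x)
    (hdiag : ∀ x, A x x = 0) (z : ExpansionVertex n U → ZMod 2) (hz : ∀ j, z (.inl j) = 0)
    (hzM : ∀ w ∉ Set.range (Sum.inl : Fin n → ExpansionVertex n U),
      ∑ y, adjEntry (expansion n A U c hsymm hdiag) w y * z y = 0) : z = 0 := by
  simp only [adjEntry_expansion] at hzM
  have ha : ∀ m : ℕ, ∀ p : (Σ i : Fin n, innerBasis n U i), p.1.val < m →
      z (.inr (.inl p)) = 0 := by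
    intro m
    induction m with
    | zero => intro p hp; omega
    | succ m ih =>
      rintro ⟨i, x⟩ hp
      have h := hzM (.inr (.inr ⟨i, x⟩)) (by simp)
      rw [Fintype.sum_eq_single (.inr (.inl ⟨i, x⟩))] at h
      · simpa [expansionEntry] using h
      · rintro (j | ⟨i', y⟩ | ⟨i', y⟩) hne
        · rw [hz, mul_zero]
        · by_cases hi : i'.val + 1 = i.val
          · rw [ih ⟨i', y⟩ (by simp only at hp ⊢; omega), mul_zero]
          · have h1 : ¬ (i'.val = i.val ∧ y.val = x.val) := by
              rintro ⟨h1, h2⟩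
              obtain rfl := Fin.ext h1
              exact hne (by rw [Subtype.ext h2])
            simp only [expansionEntry, if_neg hi, if_neg h1, add_zero, zero_mul]
        · simp only [expansionEntry, zero_mul]
  have hb : ∀ m : ℕ, ∀ p : (Σ i : Fin n, innerBasis n U i), n - p.1.val < m →
      z (.inr (.inr p)) = 0 := by
    intro m
    induction m with
    | zero => intro p hp; omega
    | succ m ih =>
      rintro ⟨i, x⟩ hp
      have h := hzM (.inr (.inl ⟨i, x⟩)) (by simp)
      rw [Fintype.sum_eq_single (.inr (.inr ⟨i, x⟩))] at h
      · simpa [expansionEntry] using h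
      · rintro (j | ⟨i', y⟩ | ⟨i', y⟩) hne
        · rw [hz, mul_zero]
        · simp only [expansionEntry, zero_mul]
        · by_cases hi : i.val + 1 = i'.val
          · rw [ih ⟨i', y⟩ (by have := i'.2; simp only at hp ⊢; omega), mul_zero]
          · have h1 : ¬ (i.val = i'.val ∧ x.val = y.val) := by
              rintro ⟨h1, h2⟩
              obtain rfl := Fin.ext h1
              exact hne (by rw [Subtype.ext h2])
            simp only [expansionEntry, if_neg hi, if_neg h1, add_zero, zero_mul]
  funext w
  rcases w with j | p | p
  · exact hz j
  · exact ha _ p (Nat.lt_succ_self _)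
  · exact hb _ p (Nat.lt_succ_self _)

/-- The vector that certifies the column of the vertex `j` in the Schur complement. After the
vertex is processed, the outgoing copies carry the coefficients of its row, and before, the
ingoing copies carry its column. -/
def expansionVec (n : ℕ) (A : ℕ → ℕ → ZMod 2) (U : ℕ → Finset ℕ) (c : ℕ → ℕ → ℕ → ZMod 2)
    (j : Fin n) : ExpansionVertex n U → ZMod 2
  | .inl l => if l = j then 1 else 0
  | .inr (.inl p) => if p.1.val < stage n j then 0 else c p.1 j p.2
  | .inr (.inr p) => if p.1.val < stage n j then A p.2 j else 0

theorem sum_expansionEntry_inl (j l : Fin n) :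
    ∑ w, expansionEntry n A U c (.inl l) w * expansionVec n A U c j w =
      (if stage n l = stage n j then A l j else 0) +
      ((∑ x ∈ innerBasis n U (stage n l - 1),
          A x l * if stage n l - 1 < stage n j then 0 else c (stage n l - 1) j x) +
        ∑ y ∈ innerBasis n U (stage n l),
          c (stage n l) l y * if stage n l < stage n j then A y j else 0) := by
  rw [Fintype.sum_sum_type, Fintype.sum_sum_type]
  congr 1
  · simp [expansionEntry, expansionVec]
  have h1 := one_le_stage n l
  congr 1
  · refine (sum_layer_eq (n := n) (U := U) (fun i x => (if i + 1 = stage n l then A x l else 0) *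
      if i < stage n j then 0 else c i j x) (stage n l - 1) ?_).trans ?_
    · intro i hi x _
      rw [if_neg (by omega), zero_mul]
    · simp only [if_pos (show stage n l - 1 + 1 = stage n l by omega)]
  · refine (sum_layer_eq (n := n) (U := U) (fun i y => (if i = stage n l then c i l y else 0) *
      if i < stage n j then A y j else 0) (stage n l) ?_).trans ?_
    · intro i hi x _
      rw [if_neg (by omega), zero_mul]
    · simp only [if_true]

theorem sum_expansionEntry_outgoing (j : Fin n) (i : Fin n) (x : innerBasis n U i) :
    ∑ w, expansionEntry n A U c (.inr (.inl ⟨i, x⟩)) w * expansionVec n A U c j w =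
      (if i.val + 1 = stage n j then A x j else 0) +
      ((if i.val < stage n j then A x j else 0) + ∑ y ∈ innerBasis n U (i + 1),
          c (i + 1) x y * if i.val + 1 < stage n j then A y j else 0) := by
  rw [Fintype.sum_sum_type, Fintype.sum_sum_type]
  congr 1
  · simp [expansionEntry, expansionVec]
  simp only [expansionEntry, zero_mul, Finset.sum_const_zero, zero_add, add_mul,
    Finset.sum_add_distrib]
  congr 1
  · rw [Fintype.sum_eq_single ⟨i, x⟩]
    · simp [expansionVec]
    · rintro ⟨i', y⟩ hne
      have h1 : ¬ (i.val = i'.val ∧ x.val = y.val) := by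
        rintro ⟨h1, h2⟩
        obtain rfl := Fin.ext h1
        exact hne (by rw [Subtype.ext h2])
      rw [if_neg h1, zero_mul]
  · refine (sum_layer_eq (n := n) (U := U) (fun i' y => (if i.val + 1 = i' then c i' x y else 0) *
      if i' < stage n j then A y j else 0) (i + 1) ?_).trans ?_
    · intro i hi x _
      rw [if_neg (by omega), zero_mul]
    · simp only [if_true]

theorem sum_expansionEntry_ingoing (j : Fin n) (i : Fin n) (y : innerBasis n U i) :
    ∑ w, expansionEntry n A U c (.inr (.inr ⟨i, y⟩)) w * expansionVec n A U c j w =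
      (if i.val = stage n j then c i j y else 0) +
      ((if i.val < stage n j then 0 else c i j y) + ∑ x ∈ innerBasis n U (i - 1),
          c i x y * if i.val - 1 < stage n j then 0 else c (i - 1) j x) := by
  rw [Fintype.sum_sum_type, Fintype.sum_sum_type]
  congr 1
  · simp [expansionEntry, expansionVec]
  simp only [expansionEntry, zero_mul, Finset.sum_const_zero, add_zero, add_mul,
    Finset.sum_add_distrib]
  have hi1 := (mem_innerBasis.1 y.2).1.1
  congr 1
  · rw [Fintype.sum_eq_single ⟨i, y⟩]
    · simp [expansionVec]
    · rintro ⟨i', x⟩ hne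
      have h1 : ¬ (i'.val = i.val ∧ x.val = y.val) := by
        rintro ⟨h1, h2⟩
        obtain rfl := Fin.ext h1
        exact hne (by rw [Subtype.ext h2])
      rw [if_neg h1, zero_mul]
  · refine (sum_layer_eq (n := n) (U := U) (fun i' x => (if i' + 1 = i.val then c i x y else 0) *
      if i' < stage n j then 0 else c i' j x) (i - 1) ?_).trans ?_
    · intro i hi x _
      rw [if_neg (by omega), zero_mul]
    · simp only [if_pos (show i.val - 1 + 1 = i.val by omega)]

theorem sum_expansionEntry_inl_eq (hU : IsTailBasisChain A U c) (hsymm : ∀ x y, A x y = A y x)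
    (hn : 3 ≤ n) (j l : Fin n) :
    ∑ w, expansionEntry n A U c (.inl l) w * expansionVec n A U c j w = A l j := by
  rw [sum_expansionEntry_inl]
  have hl := one_le_stage n l
  have hj := one_le_stage n j
  have hl' := stage_le hn l
  have hj' := stage_le hn j
  rcases lt_trichotomy (stage n l) (stage n j) with h | h | h
  · rw [if_neg h.ne]
    simp only [if_pos h, if_pos (show stage n l - 1 < stage n j by omega), mul_zero,
      Finset.sum_const_zero, zero_add]
    rw [innerBasis_eq U hl (by omega)]
    exact hU.sum_coeff _ _ (le_of_stage_le (n := n) (by omega) le_rfl) _ (lt_of_lt_stage hl h)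
  · simp [h, show stage n j - 1 < stage n j by omega]
  · rw [if_neg h.ne']
    simp only [if_neg h.le.not_gt, if_neg (show ¬ stage n l - 1 < stage n j by omega), mul_zero,
      Finset.sum_const_zero, zero_add, add_zero]
    rw [innerBasis_eq U (by omega) (by omega), hsymm l j,
      ← hU.sum_coeff (stage n l - 1) j (le_of_stage_le (n := n) (by omega) (by omega)) l
        (lt_of_lt_stage (n := n) (by omega) (by omega))]
    exact Finset.sum_congr rfl fun x _ => mul_comm _ _

theorem sum_expansionEntry_outgoing_eq (hU : IsTailBasisChain A U c) (hn : 3 ≤ n) (j : Fin n)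
    (i : Fin n) (x : innerBasis n U i) :
    ∑ w, expansionEntry n A U c (.inr (.inl ⟨i, x⟩)) w * expansionVec n A U c j w = 0 := by
  rw [sum_expansionEntry_outgoing]
  have hj' := stage_le hn j
  obtain ⟨⟨hi1, hi3⟩, hx⟩ := mem_innerBasis.1 x.2
  have hxi := (hU.isTailBasis i).le_of_mem x hx
  rcases lt_trichotomy (i.val + 1) (stage n j) with h | h | h
  · rw [if_neg h.ne, if_pos (by omega)]
    simp only [if_pos h]
    rw [innerBasis_eq U (i := i.val + 1) (by omega) (by omega), hU.sum_coeff _ _ (by omega) _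
      (lt_of_lt_stage (n := n) (by omega) h), zero_add, CharTwo.add_self_eq_zero]
  · simp [h, show i.val < stage n j by omega, CharTwo.add_self_eq_zero]
  · simp [h.ne', show ¬ i.val < stage n j by omega, h.le.not_gt]

theorem sum_expansionEntry_ingoing_eq (hU : IsTailBasisChain A U c) (j : Fin n)
    (i : Fin n) (y : innerBasis n U i) :
    ∑ w, expansionEntry n A U c (.inr (.inr ⟨i, y⟩)) w * expansionVec n A U c j w = 0 := by
  rw [sum_expansionEntry_ingoing]
  have hj := one_le_stage n j
  obtain ⟨⟨hi1, hi3⟩, hy⟩ := mem_innerBasis.1 y.2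
  rcases lt_trichotomy i.val (stage n j) with h | h | h
  · simp [h.ne, h, show i.val - 1 < stage n j by omega]
  · simp [h, show stage n j - 1 < stage n j by omega, CharTwo.add_self_eq_zero]
  · rw [if_neg h.ne', if_neg h.le.not_gt]
    simp only [if_neg (show ¬ i.val - 1 < stage n j by omega)]
    rw [innerBasis_eq U (i := i.val - 1) (by omega) (by omega), zero_add, CharTwo.add_eq_zero]
    obtain ⟨m, hm⟩ : ∃ m, i.val = m + 1 := ⟨i.val - 1, by omega⟩
    generalize y.val = y' at hy ⊢
    rw [hm] at hy ⊢
    rw [Nat.add_sub_cancel, hU.coeff_succ m j (le_of_stage_le (n := n) (by omega) (by omega)) y' hy]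
    exact Finset.sum_congr rfl fun x _ => mul_comm _ _

/-- Eliminating the copies of basis elements from the rank-expansion recovers the graph. -/
theorem exists_hasPivotMinor_expansion {V : Type*} {G : SimpleGraph V} (e : V ≃ Fin n)
    (hA : ∀ u v, A (e u) (e v) = adjEntry G u v) (hU : IsTailBasisChain A U c) (hn : 3 ≤ n)
    (hsymm : ∀ x y, A x y = A y x) (hdiag : ∀ x, A x x = 0) :
    ∃ (W : Type) (F : SimpleGraph W),
      HasPivotMinor (expansion n A U c hsymm hdiag) F ∧ Nonempty (F ≃g G) := by
  have hrange : Set.range (fun v => (.inl (e v) : ExpansionVertex n U)) = Set.range Sum.inl := by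
    ext w
    constructor
    · rintro ⟨v, rfl⟩
      exact ⟨e v, rfl⟩
    · rintro ⟨j, rfl⟩
      exact ⟨e.symm j, by simp⟩
  refine exists_hasPivotMinor_of_schurComplement G _ _ (fun v => .inl (e v)) le_rfl
    (Sum.inl_injective.comp e.injective) ?_ ?_
  · intro z hz hzM
    rw [hrange] at hzM
    refine eq_zero_of_expansion_mulVec_eq_zero hsymm hdiag z (fun j => ?_) hzM
    simpa using hz (e.symm j)
  · intro y
    refine ⟨expansionVec n A U c (e y), by simp [expansionVec], ?_, ?_, ?_⟩
    · intro x hx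
      simp [expansionVec, hx]
    · intro w hw
      rw [hrange] at hw
      simp only [adjEntry_expansion]
      rcases w with j | ⟨i, x⟩ | ⟨i, x⟩
      · exact absurd ⟨j, rfl⟩ hw
      · exact sum_expansionEntry_outgoing_eq hU hn _ i x
      · exact sum_expansionEntry_ingoing_eq hU _ i x
    · intro x
      simp only [adjEntry_expansion]
      rw [sum_expansionEntry_inl_eq hU hsymm hn, hA]

end Expansion

/-! ### Size and path-width of the rank-expansion -/

section Intervals

variable {n k : ℕ} {A : ℕ → ℕ → ZMod 2} {U : ℕ → Finset ℕ} {c : ℕ → ℕ → ℕ → ZMod 2}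

theorem mul_add_le_mul_add_iff {L q q' r r' : ℕ} (hr : r < L) (hr' : r' < L) :
    q * L + r ≤ q' * L + r' ↔ q < q' ∨ q = q' ∧ r ≤ r' := by
  rcases lt_trichotomy q q' with h | h | h
  · have := Nat.mul_le_mul_right L h
    rw [Nat.succ_mul] at this
    omega
  · subst h
    omega
  · have := Nat.mul_le_mul_right L h
    rw [Nat.succ_mul] at this
    omega

/-- The first point of the interval of a vertex of the rank-expansion. Each stage takes `2 * n`
units of time: in the first half, the outgoing copies of the preceding cut are
replaced one by one by the ingoing copies of the next cut, and in the second half, these are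
replaced by the outgoing ones. -/
def expansionLo (n : ℕ) (U : ℕ → Finset ℕ) : ExpansionVertex n U → ℕ
  | .inl j => stage n j * (2 * n) + 0
  | .inr (.inl p) => p.1 * (2 * n) + (n + p.2)
  | .inr (.inr p) => p.1 * (2 * n) + p.2

/-- The last point of the interval of a vertex of the rank-expansion. -/
def expansionHi (n : ℕ) (U : ℕ → Finset ℕ) : ExpansionVertex n U → ℕ
  | .inl j => stage n j * (2 * n) + (n - 1)
  | .inr (.inl p) =>
      (p.1 + 1) * (2 * n) + if p.2.val ∈ innerBasis n U (p.1 + 1) then p.2.val else n - 1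
  | .inr (.inr p) => p.1 * (2 * n) + (n + p.2)

theorem lt_of_mem_innerBasis (hU : IsTailBasisChain A U c) {i x : ℕ}
    (hx : x ∈ innerBasis n U i) : x < n := by
  obtain ⟨hi, hx⟩ := mem_innerBasis.1 hx
  have := (hU.isTailBasis i).le_of_mem x hx
  omega

theorem expansionLo_le_expansionHi (hU : IsTailBasisChain A U c) (w : ExpansionVertex n U) :
    expansionLo n U w ≤ expansionHi n U w := by
  rcases w with j | ⟨i, x⟩ | ⟨i, x⟩
  · simp [expansionLo, expansionHi]
  · have hx := lt_of_mem_innerBasis hU x.2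
    simp only [expansionLo, expansionHi]
    split_ifs <;> rw [mul_add_le_mul_add_iff (by omega) (by omega)] <;> omega
  · simp [expansionLo, expansionHi]

theorem expansionLo_le_of_adj (hU : IsTailBasisChain A U c) (hsymm : ∀ x y, A x y = A y x)
    (hdiag : ∀ x, A x x = 0) {u v : ExpansionVertex n U}
    (huv : (expansion n A U c hsymm hdiag).Adj u v) : expansionLo n U u ≤ expansionHi n U v := by
  change expansionEntry n A U c u v = 1 at huv
  have hcoeff : ∀ i i' : Fin n, ∀ (x : innerBasis n U i) (y : innerBasis n U i'),
      (if i.val = i'.val ∧ x.val = y.val then (1 : ZMod 2) else 0) +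
        (if i.val + 1 = i'.val then c i' x y else 0) = 1 →
      (i.val = i'.val ∧ x.val = y.val) ∨
        (i.val + 1 = i'.val ∧ (x.val ∈ innerBasis n U i' → x.val = y.val)) := by
    intro i i' x y h
    by_cases h1 : i.val = i'.val ∧ x.val = y.val
    · exact .inl h1
    · rw [if_neg h1, zero_add] at h
      by_cases h2 : i.val + 1 = i'.val
      · refine .inr ⟨h2, fun hx => ?_⟩
        rw [if_pos h2, hU.coeff_of_mem i' x (mem_innerBasis.1 hx).2 y (mem_innerBasis.1 y.2).2] at h
        by_contra hxy
        simp [hxy] at h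
      · simp [h2] at h
  rcases u with j | ⟨i, x⟩ | ⟨i, x⟩ <;> rcases v with l | ⟨i', y⟩ | ⟨i', y⟩ <;>
    simp only [expansionEntry, expansionLo, expansionHi] at huv ⊢
  · have h : stage n j = stage n l := by
      by_contra h
      simp [h] at huv
    rw [h]
    omega
  · have h : i'.val + 1 = stage n j := by
      by_contra h
      simp [h] at huv
    rw [h]
    omega
  · have h : i'.val = stage n j := by
      by_contra h
      simp [h] at huv
    have hy := lt_of_mem_innerBasis hU y.2
    rw [mul_add_le_mul_add_iff (by omega) (by omega)]
    omega
  · have h : i.val + 1 = stage n l := by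
      by_contra h
      simp [h] at huv
    have hx := lt_of_mem_innerBasis hU x.2
    rw [mul_add_le_mul_add_iff (by omega) (by omega)]
    omega
  · simp at huv
  · have hx := lt_of_mem_innerBasis hU x.2
    have hy := lt_of_mem_innerBasis hU y.2
    have := hcoeff i i' x y huv
    rw [mul_add_le_mul_add_iff (by omega) (by omega)]
    omega
  · have h : i.val = stage n l := by
      by_contra h
      simp [h] at huv
    have hx := lt_of_mem_innerBasis hU x.2
    rw [mul_add_le_mul_add_iff (by omega) (by omega)]
    omega
  · have hx := lt_of_mem_innerBasis hU x.2
    have hy := lt_of_mem_innerBasis hU y.2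
    rcases hcoeff i' i y x huv with ⟨h, h'⟩ | ⟨h, h'⟩
    · split_ifs <;> rw [mul_add_le_mul_add_iff (by omega) (by omega)] <;> omega
    · rw [h]
      split_ifs with hmem
      · rw [h' hmem]
      · omega
  · simp at huv

/-- A set of vertices of the rank-expansion that has outgoing and ingoing vertices of one cut each
is counted by indices. -/
theorem encard_le_of_layers {B : Set (ExpansionVertex n U)} (X Y Z : Finset ℕ) (p q : ℕ)
    (hX : ∀ j, .inl j ∈ B → j.val ∈ X)
    (hY : ∀ i x, .inr (.inl ⟨i, x⟩) ∈ B → i.val = p ∧ x.val ∈ Y)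
    (hZ : ∀ i x, .inr (.inr ⟨i, x⟩) ∈ B → i.val = q ∧ x.val ∈ Z) :
    B.encard ≤ (X.card + Y.card + Z.card : ℕ) := by
  let f : ExpansionVertex n U → ℕ ⊕ (ℕ ⊕ ℕ) :=
    Sum.map (fun j => j.val) (Sum.map (fun p => p.2.val) (fun p => p.2.val))
  have hf : Set.MapsTo f B (X.disjSum (Y.disjSum Z) : Finset _) := by
    rintro (j | ⟨i, x⟩ | ⟨i, x⟩) hw
    · simpa [f] using hX j hw
    · simpa [f] using (hY i x hw).2
    · simpa [f] using (hZ i x hw).2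
  have hinj : Set.InjOn f B := by
    rintro (j | ⟨i, x⟩ | ⟨i, x⟩) hw (l | ⟨i', y⟩ | ⟨i', y⟩) hw' h <;> simp [f] at h
    · rw [Fin.ext h]
    · obtain rfl : i = i' := Fin.ext ((hY i x hw).1.trans (hY i' y hw').1.symm)
      rw [Subtype.ext h]
    · obtain rfl : i = i' := Fin.ext ((hZ i x hw).1.trans (hZ i' y hw').1.symm)
      rw [Subtype.ext h]
  refine (Set.encard_le_encard_of_injOn hf hinj).trans ?_
  rw [Set.encard_coe_eq_coe_finsetCard, Finset.card_disjSum, Finset.card_disjSum, add_assoc]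

theorem encard_expansion_bag_le (hU : IsTailBasisChain A U c) (hn : 3 ≤ n) (hk : 1 ≤ k)
    (hcard : ∀ i, (innerBasis n U i).card ≤ k) (t : ℕ) :
    {w : ExpansionVertex n U | expansionLo n U w ≤ t ∧ t ≤ expansionHi n U w}.encard ≤
      (k + 2 : ℕ) := by
  obtain ⟨q, r, hr, rfl⟩ : ∃ q r, r < 2 * n ∧ t = q * (2 * n) + r :=
    ⟨t / (2 * n), t % (2 * n), Nat.mod_lt _ (by omega), by rw [mul_comm, Nat.div_add_mod]⟩
  set B := {w : ExpansionVertex n U | expansionLo n U w ≤ q * (2 * n) + r ∧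
    q * (2 * n) + r ≤ expansionHi n U w}
  have hv : ∀ j : Fin n, .inl j ∈ B → stage n j = q ∧ r < n := by
    rintro j ⟨h1, h2⟩
    simp only [expansionLo, expansionHi] at h1 h2
    rw [mul_add_le_mul_add_iff (by omega) (by omega)] at h1 h2
    omega
  have ha : ∀ i x, .inr (.inl ⟨i, x⟩) ∈ B → (i.val = q ∧ n + x.val ≤ r) ∨
      (i.val + 1 = q ∧ r < n ∧ (x.val ∈ innerBasis n U q → r ≤ x.val)) := by
    rintro i x ⟨h1, h2⟩
    have hx := lt_of_mem_innerBasis hU x.2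
    simp only [expansionLo, expansionHi] at h1 h2
    rw [mul_add_le_mul_add_iff (by omega) (by omega)] at h1
    split_ifs at h2 with hmem <;> rw [mul_add_le_mul_add_iff (by omega) (by omega)] at h2
    · omega
    · rcases h1 with h1 | h1
      · obtain rfl : i.val + 1 = q := by omega
        exact .inr ⟨rfl, by omega, fun h => absurd h hmem⟩
      · exact .inl ⟨h1.1, h1.2⟩
  have hb : ∀ i x, .inr (.inr ⟨i, x⟩) ∈ B → i.val = q ∧ x.val ≤ r ∧ r ≤ n + x.val := by
    rintro i x ⟨h1, h2⟩
    have hx := lt_of_mem_innerBasis hU x.2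
    simp only [expansionLo, expansionHi] at h1 h2
    rw [mul_add_le_mul_add_iff (by omega) (by omega)] at h1 h2
    omega
  have hvalid : ∀ {i : Fin n} (x : innerBasis n U i), 1 ≤ i.val ∧ i.val + 3 ≤ n :=
    fun x => (mem_innerBasis.1 x.2).1
  have hmem : ∀ {i : Fin n} (x : innerBasis n U i) {j : ℕ}, i.val = j →
      x.val ∈ innerBasis n U j := by
    rintro i x _ rfl
    exact x.2
  have hcast : ∀ {m : ℕ}, B.encard ≤ (m : ℕ) → m ≤ k + 2 → B.encard ≤ (k + 2 : ℕ) :=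
    fun h1 h2 => h1.trans (by exact_mod_cast h2)
  by_cases hrn : n ≤ r
  · -- Ingoing copies are being replaced by outgoing copies; only one is present twice.
    refine hcast (encard_le_of_layers ∅ ((innerBasis n U q).filter (· ≤ r - n))
      ((innerBasis n U q).filter (r - n ≤ ·)) q q ?_ ?_ ?_) ?_
    · intro j hj
      have := hv j hj
      omega
    · intro i x hx
      rcases ha i x hx with ⟨rfl, h⟩ | h
      · exact ⟨rfl, Finset.mem_filter.2 ⟨x.2, by omega⟩⟩
      · omega
    · intro i x hx
      obtain ⟨rfl, h⟩ := hb i x hx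
      exact ⟨rfl, Finset.mem_filter.2 ⟨x.2, by omega⟩⟩
    · have h1 : (innerBasis n U q).filter (r - n ≤ ·) ⊆
          insert (r - n) ((innerBasis n U q).filter (¬ · ≤ r - n)) := by
        intro x hx
        rw [Finset.mem_filter] at hx
        rw [Finset.mem_insert, Finset.mem_filter]
        rcases hx.2.eq_or_lt with h | h
        · exact .inl h.symm
        · exact .inr ⟨hx.1, by omega⟩
      have h2 := (Finset.card_le_card h1).trans (Finset.card_insert_le _ _)
      have h3 := Finset.card_filter_add_card_filter_not (s := innerBasis n U q) (· ≤ r - n)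
      have h4 := hcard q
      rw [Finset.card_empty]
      omega
  push Not at hrn
  by_cases hq : q = 0 ∨ n - 2 < q
  · refine hcast (encard_le_of_layers ∅ ∅ ∅ 0 0 ?_ ?_ ?_) (by simp)
    · intro j hj
      have := hv j hj
      have := one_le_stage n j
      have := stage_le hn j
      omega
    · intro i x hx
      have := ha i x hx
      have := hvalid x
      omega
    · intro i x hx
      have := hb i x hx
      have := hvalid x
      omega
  by_cases hn3 : n = 3
  · refine hcast (encard_le_of_layers (Finset.range n) ∅ ∅ 0 0 ?_ ?_ ?_)
      (by simp only [Finset.card_range, Finset.card_empty]; omega)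
    · intro j _
      exact Finset.mem_range.2 j.2
    · intro i x _
      have := hvalid x
      omega
    · intro i x _
      have := hvalid x
      omega
  by_cases hq1 : q = 1
  · refine hcast (encard_le_of_layers {0, 1} ∅ (innerBasis n U q) 0 q ?_ ?_ ?_) ?_
    · intro j hj
      have := hv j hj
      unfold stage at this
      simp only [Finset.mem_insert, Finset.mem_singleton]
      omega
    · intro i x hx
      have := ha i x hx
      have := hvalid x
      omega
    · intro i x hx
      obtain ⟨rfl, h⟩ := hb i x hx
      exact ⟨rfl, x.2⟩
    · have := hcard q
      have := Finset.card_le_two (a := 0) (b := 1)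
      rw [Finset.card_empty]
      omega
  by_cases hq2 : q = n - 2
  · refine hcast (encard_le_of_layers {n - 2, n - 1} (innerBasis n U (q - 1)) ∅ (q - 1) 0
      ?_ ?_ ?_) ?_
    · intro j hj
      have := hv j hj
      unfold stage at this
      simp only [Finset.mem_insert, Finset.mem_singleton]
      omega
    · intro i x hx
      have := ha i x hx
      obtain rfl : i.val + 1 = q := by omega
      exact ⟨rfl, x.2⟩
    · intro i x hx
      have := hb i x hx
      have := hvalid x
      omega
    · have := hcard (q - 1)
      have := Finset.card_le_two (a := n - 2) (b := n - 1)
      rw [Finset.card_empty]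
      omega
  obtain ⟨m, rfl⟩ : ∃ m, q = m + 1 := ⟨q - 1, by omega⟩
  have hm : innerBasis n U m = U m := innerBasis_eq U (by omega) (by omega)
  have hm1 : innerBasis n U (m + 1) = U (m + 1) := innerBasis_eq U (by omega) (by omega)
  have hcm := hcard m
  have hcm1 := hcard (m + 1)
  have hvX : ∀ j : Fin n, .inl j ∈ B → j.val ∈ ({m + 1} : Finset ℕ) := by
    intro j hj
    have := hv j hj
    unfold stage at this
    rw [Finset.mem_singleton]
    omega
  by_cases hrm : r < m + 1
  · refine hcast (encard_le_of_layers {m + 1} ((U m).filter fun x => x ∈ U (m + 1) → r ≤ x)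
      ((U (m + 1)).filter (· ≤ r)) m (m + 1) hvX ?_ ?_) ?_
    · intro i x hx
      have h := ha i x hx
      obtain rfl : i.val = m := by omega
      refine ⟨rfl, Finset.mem_filter.2 ⟨hm ▸ x.2, fun h' => ?_⟩⟩
      rw [hm1] at h
      rcases h with h | h
      · omega
      · exact h.2.2 h'
    · intro i x hx
      have h := hb i x hx
      have hx' := hmem x h.1
      rw [hm1] at hx'
      exact ⟨h.1, Finset.mem_filter.2 ⟨hx', h.2.1⟩⟩
    · -- Apart from `r`, each basis element is present in one copy only.
      have h1 : (U (m + 1)).filter (· ≤ r) ⊆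
          insert r ((U m).filter fun x => ¬ (x ∈ U (m + 1) → r ≤ x)) := by
        intro x hx
        rw [Finset.mem_filter] at hx
        rw [Finset.mem_insert, Finset.mem_filter]
        rcases hx.2.eq_or_lt with h | h
        · exact .inl h
        · refine .inr ⟨?_, fun h' => absurd (h' hx.1) (by omega)⟩
          rcases Finset.mem_insert.1 (hU.subset_insert m hx.1) with h' | h'
          · omega
          · exact h'
      have h2 := (Finset.card_le_card h1).trans (Finset.card_insert_le _ _)
      have h3 := Finset.card_filter_add_card_filter_not (s := U m)
        (fun x => x ∈ U (m + 1) → r ≤ x)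
      rw [hm] at hcm
      rw [Finset.card_singleton]
      omega
  · -- Of the outgoing copies, only that of the discarded basis element is left.
    refine hcast (encard_le_of_layers {m + 1} (U m \ U (m + 1)) (U (m + 1)) m (m + 1) hvX ?_ ?_) ?_
    · intro i x hx
      have h := ha i x hx
      obtain rfl : i.val = m := by omega
      have hxU : x.val ∈ U i := hm ▸ x.2
      have hxi := (hU.isTailBasis i).le_of_mem x hxU
      refine ⟨rfl, Finset.mem_sdiff.2 ⟨hxU, fun h' => ?_⟩⟩
      rw [hm1] at h
      rcases h with h | h
      · omega
      · have := h.2.2 h'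
        omega
    · intro i x hx
      have h := hb i x hx
      have hx' := hmem x h.1
      rw [hm1] at hx'
      exact ⟨h.1, hx'⟩
    · have := hU.card_sdiff m
      rw [hm1] at hcm1
      rw [Finset.card_singleton]
      omega

theorem pathWidth_expansion_le (hU : IsTailBasisChain A U c) (hsymm : ∀ x y, A x y = A y x)
    (hdiag : ∀ x, A x x = 0) (hn : 3 ≤ n) (hk : 1 ≤ k)
    (hcard : ∀ i, (innerBasis n U i).card ≤ k) :
    pathWidth (expansion n A U c hsymm hdiag) ≤ (k : ℕ∞) + 1 := by
  have h := pathWidth_le_of_intervals (expansion n A U c hsymm hdiag) (expansionLo n U)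
    (expansionHi n U) (k + 1) (expansionLo_le_expansionHi hU)
    (fun u v huv => expansionLo_le_of_adj hU hsymm hdiag huv)
    (fun t => by exact_mod_cast encard_expansion_bag_le hU hn hk hcard t)
  exact_mod_cast h

/-- There are `n - 3` inner cuts, each with at most `k` basis elements. -/
theorem card_expansionVertex_le (hn : 3 ≤ n) (hcard : ∀ i, (innerBasis n U i).card ≤ k) :
    Fintype.card (ExpansionVertex n U) ≤ n + 2 * ((n - 3) * k) := by
  have h : ∑ i : Fin n, (innerBasis n U i).card ≤ (n - 3) * k := by
    rw [← Finset.sum_range fun i => (innerBasis n U i).card]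
    have h1 : ∑ i ∈ Finset.Icc 1 (n - 3), (innerBasis n U i).card =
        ∑ i ∈ Finset.range n, (innerBasis n U i).card := by
      refine Finset.sum_subset ?_ ?_
      · intro i hi
        rw [Finset.mem_Icc] at hi
        rw [Finset.mem_range]
        omega
      · intro i _ hi
        rw [Finset.mem_Icc] at hi
        rw [innerBasis, if_neg (by omega), Finset.card_empty]
    rw [← h1]
    refine (Finset.sum_le_card_nsmul _ _ k fun i _ => hcard i).trans ?_
    simp
  simp only [Fintype.card_sum, Fintype.card_sigma, Fintype.card_coe, Fintype.card_fin]
  omega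

end Intervals
end GraphWidth

open GraphWidth in
theorem theorem3p2 {V : Type*} [Fintype V] (G : SimpleGraph V) (k : ℕ)
    (hG : GraphWidth.linearRankWidth G ≤ (k : ℕ∞)) (hV : 3 ≤ Fintype.card V) :
    ∃ (W : Type) (_ : Fintype W) (H : SimpleGraph W),
      (∃ (U : Type) (K : SimpleGraph U), GraphWidth.HasPivotMinor H K ∧ Nonempty (K ≃g G)) ∧
      GraphWidth.pathWidth H ≤ (k : ℕ∞) + 1 ∧
      (Fintype.card W : ℤ) ≤ (2 * (k : ℤ) + 1) * (Fintype.card V : ℤ) - 6 * (k : ℤ) := by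
  obtain ⟨D, hD⟩ := exists_linearRankDecomposition_of_linearRankWidth_le hG (by omega)
  rcases Nat.eq_zero_or_pos k with rfl | hk
  · -- The graph has no edges, and `H = G`.
    refine ⟨Fin (Fintype.card V), inferInstance, ⊥, ⟨_, ⊥, .refl,
      ⟨⟨(Fintype.equivFin V).symm, ?_⟩⟩⟩, ?_, ?_⟩
    · intro x y
      simpa using D.not_adj_of_width_eq_zero (by simpa using hD) _ _
    · have h := pathWidth_le_of_intervals (⊥ : SimpleGraph (Fin (Fintype.card V)))
        (fun i => i.val) (fun i => i.val) 1 (fun _ => le_rfl) (fun u v huv => by simp at huv)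
        (fun t => by
          refine (Set.encard_le_one_iff.2 fun a b ha hb => Fin.ext ?_).trans (by simp)
          exact (le_antisymm ha.1 ha.2).trans (le_antisymm hb.1 hb.2).symm)
      simpa using h
    · simp
  obtain ⟨e, he⟩ := D.exists_order hD
  let f : V ↪ ℕ := e.toEmbedding.trans Fin.valEmbedding
  let G' : SimpleGraph ℕ := G.map f
  have hA : ∀ u v, adjEntry G' (e u) (e v) = adjEntry G u v := by
    intro u v
    have h : G'.Adj (e u) (e v) ↔ G.Adj u v := SimpleGraph.map_adj_apply (f := f)
    by_cases huv : G.Adj u v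
    · rw [adjEntry_eq_one.2 huv, adjEntry_eq_one.2 (h.2 huv)]
    · rw [adjEntry_eq_zero.2 huv, adjEntry_eq_zero.2 (fun h' => huv (h.1 h'))]
  have hA0 : ∀ x y, Fintype.card V ≤ y → adjEntry G' x y = 0 := by
    intro x y hy
    rw [adjEntry_eq_zero]
    rintro ⟨-, u, v, -, -, rfl⟩
    exact absurd (e v).2 (not_lt.2 hy)
  obtain ⟨U, c, hU⟩ := exists_isTailBasisChain (adjEntry G')
  have hcard : ∀ i, (innerBasis (Fintype.card V) U i).card ≤ k := by
    intro i
    unfold innerBasis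
    split_ifs with hi
    · exact ((hU.isTailBasis i).card_le_cutRank e hA hA0 (by omega)).trans
        (he (i + 1) (by omega) (by omega))
    · simp
  refine ⟨ExpansionVertex (Fintype.card V) U, inferInstance,
    expansion (Fintype.card V) (adjEntry G') U c (adjEntry_comm G') (adjEntry_self G'),
    exists_hasPivotMinor_expansion e hA hU hV _ _, pathWidth_expansion_le hU _ _ hV hk hcard, ?_⟩
  have h := card_expansionVertex_le (U := U) hV hcard
  obtain ⟨m, hm⟩ : ∃ m, Fintype.card V = m + 3 := ⟨Fintype.card V - 3, by omega⟩
  have h' : (Fintype.card (ExpansionVertex (Fintype.card V) U) : ℤ) ≤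
      ((Fintype.card V + 2 * ((Fintype.card V - 3) * k) : ℕ) : ℤ) := by exact_mod_cast h
  refine h'.trans (le_of_eq ?_)
  rw [hm, Nat.add_sub_cancel]
  push_cast
  ring
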